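/- **Theorem.** There exist universal constants $c, p > 0$ such that the following holds for all dimensions $d_x, d_u$. Let $R_x \in \mathbb{R}^{d_x\times d_x}$ be symmetric with $R_x \succeq I$ and let $R_u = I \in \mathbb{R}^{d_u \times d_u}$. Call $(A,B) \in \mathbb{R}^{d_x\times d_x}\times\mathbb{R}^{d_x\times d_u}$ *stabilizable* if there is a $K \in \mathbb{R}^{d_u\times d_x}$ such that $A+BK$ has spectral radius $\rho(A+BK)<1$. For stabilizable $(A,B)$ let $P_\infty(A,B)$ be the (unique) positive semidefinite solution of the discrete algebraic Riccati equation $$P = A^\top P A - A^\top P B (R_u + B^\top P B)^{-1} B^\top P A + R_x,$$ and let $$K_\infty(A,B) = -(R_u + B^\top P_\infty(A,B) B)^{-1} B^\top P_\infty(A,B) A ,\qquad C_{\mathrm{safe}}(A,B) = 54\,\|P_\infty(A,B)\|_{\mathrm{op}}^5 .$$ Let $(A_\star,B_\star)$ be stabilizable, write $P_\star = P_\infty(A_\star,B_\star)$ and $K_\star = K_\infty(A_\star,B_\star)$, let $(\widehat A,\widehat B)$ be another pair of matrices of the same sizes, and for $\circ \in \{\mathrm{op}, F\}$ (spectral norm,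 Frobenius norm) put $\epsilon_\circ = \max\{\|\widehat A - A_\star\|_\circ, \|\widehat B - B_\star\|_\circ\}$. Suppose that $\epsilon_{\mathrm{op}} \le 1/C_{\mathrm{safe}}(A_\star,B_\star)$. Then $(A_\star + t(\widehat A - A_\star),\, B_\star + t(\widehat B - B_\star))$ is stabilizable for every $t\in[0,1]$, the derivative $$K' = \frac{d}{dt} K_\infty\bigl(A_\star + t(\widehat A - A_\star),\, B_\star + t(\widehat B - B_\star)\bigr)\Big|_{t=0}$$ exists, and for both $\circ = \mathrm{op}$ and $\circ = F$ $$\bigl\|K_\infty(\widehat A,\widehat B) - (K_\star + K')\bigr\|_\circ^2 \le c\, \|P_\star\|_{\mathrm{op}}^p\, \epsilon_{\mathrm{op}}^2\, \epsilon_\circ^2 .$$ -/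

import Mathlib

/-- The two matrix norms: the spectral (operator) norm and the Frobenius norm. -/
inductive MatNorm
  | op
  | fro

section OperatorNorm

open scoped Matrix.Norms.L2Operator

/-- The spectral norm of a rectangular real matrix (operator norm for the Euclidean norms). -/
noncomputable def opNorm {n m : ℕ} (M : Matrix (Fin n) (Fin m) ℝ) : ℝ := ‖M‖

end OperatorNorm

section FrobeniusNorm

open scoped Matrix.Norms.Frobenius

/-- The Frobenius norm of a rectangular real matrix. -/
noncomputable def froNorm {n m : ℕ} (M : Matrix (Fin n) (Fin m) ℝ) : ℝ := ‖M‖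

end FrobeniusNorm

namespace LQR

open scoped Matrix

/-- The norm of a matrix of the given kind. -/
noncomputable def circNorm (ν : MatNorm) {n m : ℕ} (M : Matrix (Fin n) (Fin m) ℝ) : ℝ :=
  match ν with
  | MatNorm.op => opNorm M
  | MatNorm.fro => froNorm M

variable {n m : ℕ}

/-- A real square matrix is stable if its (complex) spectral radius is less than one. -/
def Stable (X : Matrix (Fin n) (Fin n) ℝ) : Prop :=
  spectralRadius ℂ (X.map (algebraMap ℝ ℂ)) < 1

/-- `(A, B)` is stabilizable if `A + B K` is stable for some controller `K`. -/
def Stabilizable (A : Matrix (Fin n) (Fin n) ℝ) (B : Matrix (Fin n) (Fin m) ℝ) : Prop :=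
  ∃ K : Matrix (Fin m) (Fin n) ℝ, Stable (A + B * K)

/-- `P` is a positive semidefinite solution of the discrete algebraic Riccati equation. -/
def IsDARESolution (Rx : Matrix (Fin n) (Fin n) ℝ) (Ru : Matrix (Fin m) (Fin m) ℝ)
    (A : Matrix (Fin n) (Fin n) ℝ) (B : Matrix (Fin n) (Fin m) ℝ)
    (P : Matrix (Fin n) (Fin n) ℝ) : Prop :=
  P.PosSemidef ∧ P = Aᵀ * P * A - Aᵀ * P * B * (Ru + Bᵀ * P * B)⁻¹ * Bᵀ * P * A + Rx

open Classical in
/-- `P_∞(A, B)`: the positive semidefinite solution of the Riccati equation. It exists and is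
unique when `(A, B)` is stabilizable and `Rx`, `Ru` are positive definite; the value is `0` when
there is no such solution. -/
noncomputable def Pinf (Rx : Matrix (Fin n) (Fin n) ℝ) (Ru : Matrix (Fin m) (Fin m) ℝ)
    (A : Matrix (Fin n) (Fin n) ℝ) (B : Matrix (Fin n) (Fin m) ℝ) :
    Matrix (Fin n) (Fin n) ℝ :=
  if h : ∃ P, IsDARESolution Rx Ru A B P then h.choose else 0

/-- `K_∞(A, B) = -(Ru + Bᵀ P B)⁻¹ Bᵀ P A` with `P = P_∞(A, B)`: the optimal infinite-horizon
controller. -/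
noncomputable def Kinf (Rx : Matrix (Fin n) (Fin n) ℝ) (Ru : Matrix (Fin m) (Fin m) ℝ)
    (A : Matrix (Fin n) (Fin n) ℝ) (B : Matrix (Fin n) (Fin m) ℝ) :
    Matrix (Fin m) (Fin n) ℝ :=
  -((Ru + Bᵀ * Pinf Rx Ru A B * B)⁻¹ * Bᵀ * Pinf Rx Ru A B * A)

/-- `C_safe(A, B) = 54 ‖P_∞(A, B)‖_op ^ 5`. -/
noncomputable def Csafe (Rx : Matrix (Fin n) (Fin n) ℝ) (Ru : Matrix (Fin m) (Fin m) ℝ)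
    (A : Matrix (Fin n) (Fin n) ℝ) (B : Matrix (Fin n) (Fin m) ℝ) : ℝ :=
  54 * opNorm (Pinf Rx Ru A B) ^ 5

/-- `ε_∘ = max {‖Â - A‖_∘, ‖B̂ - B‖_∘}`. -/
noncomputable def modelErr (ν : MatNorm) (A A' : Matrix (Fin n) (Fin n) ℝ)
    (B B' : Matrix (Fin n) (Fin m) ℝ) : ℝ :=
  max (circNorm ν (A' - A)) (circNorm ν (B' - B))

end LQR

/-!
Let `P, K, L` and `P₁, K₁, L₁` be the cost-to-go, the optimal controller and the closed loop matrix
of two systems at distance `ε`. For small `ε` the matrix `2P` is still a Lyapunov function for the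
second system under `K`, so that system is stabilizable and `P₁ ≤ 2P`.

The optimal controller is a critical point of the quadratic one-step cost. Testing each Riccati
equation against the controller of the other system therefore yields the Sylvester equation
`P₁ - P = L₁ᵀ (P₁ - P) L + S`, exactly and with `S = O(ε)`. As `P` and `P₁` are Lyapunov functions
for `L` and `L₁`, the powers of `L` and `L₁` decay geometrically at a rate that depends only on
`‖P‖`, which bounds `P₁ - P`. Replacing `P₁, L₁` by `P, L` in this equation linearizes it; its
solution is the derivative of the cost-to-go, and the difference solves a Sylvester equation with a
source of size `O(ε²)`. The expansion of the controller follows. Its constants do not involve `‖B‖`,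
since `(Ru + Bᵀ P B)⁻¹`, `B (Ru + Bᵀ P B)⁻¹` and `B (Ru + Bᵀ P B)⁻¹ Bᵀ` all have norm at most `1`
when `P, Ru ≥ 1`.
-/

namespace LQR

open Filter Matrix
open scoped Matrix MatrixOrder Topology

section Norms

variable {n m l : ℕ}

section Operator

open scoped Matrix.Norms.L2Operator

lemma opNorm_nonneg (X : Matrix (Fin n) (Fin m) ℝ) : 0 ≤ opNorm X := norm_nonneg X

lemma opNorm_add_le (X Y : Matrix (Fin n) (Fin m) ℝ) : opNorm (X + Y) ≤ opNorm X + opNorm Y :=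
  norm_add_le X Y

lemma opNorm_smul (a : ℝ) (X : Matrix (Fin n) (Fin m) ℝ) : opNorm (a • X) = |a| * opNorm X :=
  norm_smul a X

lemma opNorm_mul_le (A : Matrix (Fin n) (Fin m) ℝ) (X : Matrix (Fin m) (Fin l) ℝ) :
    opNorm (A * X) ≤ opNorm A * opNorm X := l2_opNorm_mul A X

lemma opNorm_transpose (X : Matrix (Fin n) (Fin m) ℝ) : opNorm Xᵀ = opNorm X := by
  rw [← conjTranspose_eq_transpose_of_trivial]
  exact l2_opNorm_conjTranspose X

lemma opNorm_eq_zero {X : Matrix (Fin n) (Fin m) ℝ} : opNorm X = 0 ↔ X = 0 := norm_eq_zero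

lemma norm_toLp_mulVec_le (A : Matrix (Fin n) (Fin m) ℝ) (x : Fin m → ℝ) :
    ‖WithLp.toLp 2 (A *ᵥ x)‖ ≤ opNorm A * ‖WithLp.toLp 2 x‖ :=
  l2_opNorm_mulVec A (WithLp.toLp 2 x)

end Operator

section Frobenius

open scoped Matrix.Norms.Frobenius

lemma froNorm_nonneg (X : Matrix (Fin n) (Fin m) ℝ) : 0 ≤ froNorm X := norm_nonneg X

lemma froNorm_add_le (X Y : Matrix (Fin n) (Fin m) ℝ) :
    froNorm (X + Y) ≤ froNorm X + froNorm Y := norm_add_le X Y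

lemma froNorm_smul (a : ℝ) (X : Matrix (Fin n) (Fin m) ℝ) : froNorm (a • X) = |a| * froNorm X :=
  norm_smul a X

lemma froNorm_transpose (X : Matrix (Fin n) (Fin m) ℝ) : froNorm Xᵀ = froNorm X :=
  frobenius_norm_transpose X

lemma froNorm_eq_zero {X : Matrix (Fin n) (Fin m) ℝ} : froNorm X = 0 ↔ X = 0 := norm_eq_zero

lemma froNorm_sq (X : Matrix (Fin n) (Fin m) ℝ) :
    froNorm X ^ 2 = ∑ j, ‖WithLp.toLp 2 (X.col j)‖ ^ 2 := by
  unfold froNorm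
  rw [frobenius_norm_def, ← Real.sqrt_eq_rpow, Real.sq_sqrt (by positivity), Finset.sum_comm]
  simp [EuclideanSpace.norm_sq_eq]

end Frobenius

lemma froNorm_mul_le (A : Matrix (Fin n) (Fin m) ℝ) (X : Matrix (Fin m) (Fin l) ℝ) :
    froNorm (A * X) ≤ opNorm A * froNorm X := by
  have hA := opNorm_nonneg A
  refine le_of_sq_le_sq ?_ (mul_nonneg hA (froNorm_nonneg X))
  rw [mul_pow, froNorm_sq, froNorm_sq, Finset.mul_sum]
  gcongr with j
  rw [← mul_pow]
  gcongr
  exact norm_toLp_mulVec_le A (X.col j)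

variable (ν : MatNorm)

lemma circNorm_nonneg (X : Matrix (Fin n) (Fin m) ℝ) : 0 ≤ circNorm ν X := by
  cases ν
  exacts [opNorm_nonneg X, froNorm_nonneg X]

lemma circNorm_add_le (X Y : Matrix (Fin n) (Fin m) ℝ) :
    circNorm ν (X + Y) ≤ circNorm ν X + circNorm ν Y := by
  cases ν
  exacts [opNorm_add_le X Y, froNorm_add_le X Y]

lemma circNorm_smul (a : ℝ) (X : Matrix (Fin n) (Fin m) ℝ) :
    circNorm ν (a • X) = |a| * circNorm ν X := by
  cases ν
  exacts [opNorm_smul a X, froNorm_smul a X]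

lemma circNorm_neg (X : Matrix (Fin n) (Fin m) ℝ) : circNorm ν (-X) = circNorm ν X := by
  simpa using circNorm_smul ν (-1) X

lemma circNorm_transpose (X : Matrix (Fin n) (Fin m) ℝ) : circNorm ν Xᵀ = circNorm ν X := by
  cases ν
  exacts [opNorm_transpose X, froNorm_transpose X]

lemma circNorm_eq_zero {X : Matrix (Fin n) (Fin m) ℝ} : circNorm ν X = 0 ↔ X = 0 := by
  cases ν
  exacts [opNorm_eq_zero, froNorm_eq_zero]

lemma circNorm_mul_le_opNorm_mul (A : Matrix (Fin n) (Fin m) ℝ) (X : Matrix (Fin m) (Fin l) ℝ) :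
    circNorm ν (A * X) ≤ opNorm A * circNorm ν X := by
  cases ν
  exacts [opNorm_mul_le A X, froNorm_mul_le A X]

lemma circNorm_mul_le_mul_opNorm (X : Matrix (Fin n) (Fin m) ℝ) (A : Matrix (Fin m) (Fin l) ℝ) :
    circNorm ν (X * A) ≤ circNorm ν X * opNorm A := by
  rw [← circNorm_transpose, transpose_mul, mul_comm, ← circNorm_transpose ν X, ← opNorm_transpose A]
  exact circNorm_mul_le_opNorm_mul ν _ _

variable {ν} {a b : ℝ}

lemma circNorm_transpose_le {X : Matrix (Fin n) (Fin m) ℝ} (hX : circNorm ν X ≤ a) :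
    circNorm ν Xᵀ ≤ a := (circNorm_transpose ν X).trans_le hX

lemma circNorm_add_le_of_le {X Y : Matrix (Fin n) (Fin m) ℝ} (hX : circNorm ν X ≤ a)
    (hY : circNorm ν Y ≤ b) : circNorm ν (X + Y) ≤ a + b :=
  (circNorm_add_le ν X Y).trans (add_le_add hX hY)

lemma circNorm_mul_le_of_opNorm_le_left {A : Matrix (Fin n) (Fin m) ℝ}
    {X : Matrix (Fin m) (Fin l) ℝ} (hA : opNorm A ≤ a) (hX : circNorm ν X ≤ b) :
    circNorm ν (A * X) ≤ a * b :=
  (circNorm_mul_le_opNorm_mul ν A X).trans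
    (mul_le_mul hA hX (circNorm_nonneg ν X) ((opNorm_nonneg A).trans hA))

lemma circNorm_mul_le_of_opNorm_le_right {X : Matrix (Fin n) (Fin m) ℝ}
    {A : Matrix (Fin m) (Fin l) ℝ} (hX : circNorm ν X ≤ a) (hA : opNorm A ≤ b) :
    circNorm ν (X * A) ≤ a * b :=
  (circNorm_mul_le_mul_opNorm ν X A).trans
    (mul_le_mul hX hA (opNorm_nonneg A) ((circNorm_nonneg ν X).trans hX))

end Norms

section ModelError

variable {n m : ℕ} (ν : MatNorm) (A A₁ : Matrix (Fin n) (Fin n) ℝ) (B B₁ : Matrix (Fin n) (Fin m) ℝ)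

lemma circNorm_sub_le_modelErr_left : circNorm ν (A₁ - A) ≤ modelErr ν A A₁ B B₁ :=
  le_max_left _ _

lemma circNorm_sub_le_modelErr_right : circNorm ν (B₁ - B) ≤ modelErr ν A A₁ B B₁ :=
  le_max_right _ _

lemma modelErr_nonneg : 0 ≤ modelErr ν A A₁ B B₁ :=
  (circNorm_nonneg ν _).trans (circNorm_sub_le_modelErr_left ν A A₁ B B₁)

lemma modelErr_add_smul_sub (t : ℝ) :
    modelErr ν A (A + t • (A₁ - A)) B (B + t • (B₁ - B)) = |t| * modelErr ν A A₁ B B₁ := by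
  simp only [modelErr, add_sub_cancel_left, circNorm_smul, mul_max_of_nonneg _ _ (abs_nonneg t)]

end ModelError

section LoewnerOrder

open scoped Matrix.Norms.L2Operator

variable {ι κ : Type*}

lemma isSymm_of_nonneg {P : Matrix ι ι ℝ} (hP : 0 ≤ P) : P.IsSymm := by
  rw [IsSymm, ← conjTranspose_eq_transpose_of_trivial]
  exact hP.posSemidef.isHermitian

instance [Finite ι] : OrderClosedTopology (Matrix ι ι ℝ) := by
  cases nonempty_fintype ι
  have h : {p : Matrix ι ι ℝ × Matrix ι ι ℝ | p.1 ≤ p.2} = {p | (p.2 - p.1).IsHermitian} ∩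
      ⋂ x : ι → ℝ, {p | 0 ≤ star x ⬝ᵥ ((p.2 - p.1) *ᵥ x)} := by
    ext p
    simp [le_iff, posSemidef_iff_dotProduct_mulVec]
  refine ⟨h ▸ (isClosed_eq (by fun_prop) (by fun_prop)).inter (isClosed_iInter fun x => ?_)⟩
  exact isClosed_le (by fun_prop) (by fun_prop)

section Congruence

variable [Fintype ι] [Finite κ]

lemma transpose_mul_mul_mono {P Q : Matrix ι ι ℝ} (h : P ≤ Q) (C : Matrix ι κ ℝ) :
    Cᵀ * P * C ≤ Cᵀ * Q * C := by
  cases nonempty_fintype κ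
  have := (le_iff.1 h).conjTranspose_mul_mul_same C
  rwa [conjTranspose_eq_transpose_of_trivial, Matrix.mul_sub, Matrix.sub_mul] at this

lemma transpose_mul_mul_nonneg {P : Matrix ι ι ℝ} (hP : 0 ≤ P) (C : Matrix ι κ ℝ) :
    0 ≤ Cᵀ * P * C := by
  simpa using transpose_mul_mul_mono hP C

lemma transpose_mul_self_nonneg (C : Matrix ι κ ℝ) : 0 ≤ Cᵀ * C := by
  simpa using (posSemidef_conjTranspose_mul_self C).nonneg

end Congruence

section NormBounds

variable [Fintype ι] [DecidableEq ι]

lemma le_norm_smul_one {P : Matrix ι ι ℝ} (hP : P.IsSymm) : P ≤ ‖P‖ • 1 := by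
  have hP' : IsSelfAdjoint P := hP
  rw [← Algebra.algebraMap_eq_smul_one]
  exact le_algebraMap_of_spectrum_le fun r hr => (Real.le_norm_self r).trans
    (IsometricContinuousFunctionalCalculus.norm_spectrum_le P hr hP')

lemma norm_le_of_nonneg_of_le_smul_one {P : Matrix ι ι ℝ} {c : ℝ} (hc : 0 ≤ c) (hP : 0 ≤ P)
    (hPc : P ≤ c • 1) : ‖P‖ ≤ c := by
  have hP' : IsSelfAdjoint P := isSymm_of_nonneg hP
  rw [← Algebra.algebraMap_eq_smul_one] at hPc
  rcases subsingleton_or_nontrivial (Matrix ι ι ℝ)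
  · simpa [Subsingleton.elim P 0] using hc
  · obtain ⟨r, hr, hrP⟩ :=
      (IsometricContinuousFunctionalCalculus.isGreatest_norm_spectrum (𝕜 := ℝ) P hP').1
    rw [← hrP]
    simp only [Real.norm_of_nonneg (spectrum_nonneg_of_nonneg hP hr)]
    exact (le_algebraMap_iff_spectrum_le (ha := hP')).1 hPc r hr

lemma norm_le_norm_of_nonneg_of_le {P Q : Matrix ι ι ℝ} (hP : 0 ≤ P) (hPQ : P ≤ Q) :
    ‖P‖ ≤ ‖Q‖ :=
  norm_le_of_nonneg_of_le_smul_one (norm_nonneg Q) hP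
    (hPQ.trans (le_norm_smul_one (isSymm_of_nonneg (hP.trans hPQ))))

variable [Fintype κ]

lemma norm_transpose_mul_self (C : Matrix κ ι ℝ) : ‖Cᵀ * C‖ = ‖C‖ ^ 2 := by
  classical
  rw [← conjTranspose_eq_transpose_of_trivial, l2_opNorm_conjTranspose_mul_self, sq]

lemma transpose_mul_self_le_iff_norm_le {C : Matrix κ ι ℝ} {c : ℝ} (hc : 0 ≤ c) :
    Cᵀ * C ≤ c ^ 2 • 1 ↔ ‖C‖ ≤ c := by
  rw [← pow_le_pow_iff_left₀ (norm_nonneg C) hc two_ne_zero, ← norm_transpose_mul_self]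
  refine ⟨norm_le_of_nonneg_of_le_smul_one (sq_nonneg c) (transpose_mul_self_nonneg C), fun h => ?_⟩
  exact (le_norm_smul_one (isSymm_of_nonneg (transpose_mul_self_nonneg C))).trans
    (smul_le_smul_of_nonneg_right h zero_le_one)

lemma norm_le_one_of_transpose_mul_self_le {X : Matrix ι ι ℝ} (h : Xᵀ * X ≤ X) : ‖X‖ ≤ 1 := by
  have hsq := norm_le_norm_of_nonneg_of_le (transpose_mul_self_nonneg X) h
  rw [norm_transpose_mul_self] at hsq
  nlinarith [norm_nonneg X]

lemma isBounded_Icc (P Q : Matrix ι ι ℝ) : Bornology.IsBounded (Set.Icc P Q) :=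
  Metric.isBounded_closedBall.subset fun _ hX => mem_closedBall_iff_norm.2 <|
    norm_le_norm_of_nonneg_of_le (sub_nonneg.2 hX.1) (sub_le_sub_right hX.2 P)

end NormBounds

instance [Finite ι] : CompactIccSpace (Matrix ι ι ℝ) := by
  classical
  cases nonempty_fintype ι
  have : ProperSpace (Matrix ι ι ℝ) := FiniteDimensional.proper ℝ (Matrix ι ι ℝ)
  exact ⟨fun {P Q} => Metric.isCompact_of_isClosed_isBounded isClosed_Icc (isBounded_Icc P Q)⟩

lemma exists_tendsto_of_monotone_of_mem_compact {ι α : Type*} [Nonempty ι] [SemilatticeSup ι]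
    [TopologicalSpace α] [PartialOrder α] [OrderClosedTopology α] {u : ι → α} {s : Set α}
    (hu : Monotone u) (hs : IsCompact s) (hus : ∀ k, u k ∈ s) : ∃ a ∈ s, Tendsto u atTop (𝓝 a) := by
  have le_cluster {b : α} (hb : MapClusterPt b atTop u) (k : ι) : u k ≤ b :=
    isClosed_Ici.mem_of_mapClusterPt hb ((eventually_ge_atTop k).mono fun _ hj => hu hj)
  have cluster_le {a b : α} (ha : MapClusterPt a atTop u) (hb : MapClusterPt b atTop u) : a ≤ b :=
    isClosed_Iic.mem_of_mapClusterPt ha (.of_forall (le_cluster hb))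
  obtain ⟨a, has, ha⟩ := hs.exists_mapClusterPt (f := atTop) (u := u)
    (Filter.tendsto_principal.2 (.of_forall hus))
  exact ⟨a, has, hs.tendsto_nhds_of_unique_mapClusterPt (.of_forall hus)
    fun b _ hb => (cluster_le hb ha).antisymm (cluster_le ha hb)⟩

end LoewnerOrder

section Lyapunov

lemma eq_pow_mul_mul_pow_add_sum {R : Type*} [Semiring R] {A X B S : R} (h : X = A * X * B + S)
    (N : ℕ) : X = A ^ N * X * B ^ N + ∑ k ∈ Finset.range N, A ^ k * S * B ^ k := by
  induction N with
  | zero => simp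
  | succ N ih =>
    rw [Finset.sum_range_succ, pow_succ, pow_succ', add_comm (Finset.sum _ _), ← add_assoc]
    have hN : A ^ N * A * X * (B * B ^ N) + A ^ N * S * B ^ N = A ^ N * X * B ^ N := by
      conv_rhs => rw [h]
      simp only [mul_add, add_mul, mul_assoc]
    rwa [hN]

lemma sum_range_one_sub_inv_pow_le {p : ℝ} (hp : 1 ≤ p) (N : ℕ) :
    ∑ k ∈ Finset.range N, (1 - p⁻¹) ^ k ≤ p := by
  have h₀ : 0 ≤ 1 - p⁻¹ := sub_nonneg.2 (inv_le_one_of_one_le₀ hp)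
  have h₁ : 1 - p⁻¹ < 1 := sub_lt_self 1 (by positivity)
  simpa using sum_le_hasSum _ (fun k _ => pow_nonneg h₀ k) (hasSum_geometric_of_lt_one h₀ h₁)

section Contraction

open scoped Matrix.Norms.L2Operator

variable {ι : Type*} [Fintype ι] [DecidableEq ι]

/-- A quadratic Lyapunov certificate for the discrete-time system `x ↦ L x`: the form `xᵀ P x` is
nonnegative and drops by at least `xᵀ x` in each step. -/
structure IsLyapunov (P L : Matrix ι ι ℝ) : Prop where
  nonneg : 0 ≤ P
  decrease : Lᵀ * P * L + 1 ≤ P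

namespace IsLyapunov

variable {P L : Matrix ι ι ℝ} {p : ℝ} (h : IsLyapunov P L)
include h

lemma one_le : 1 ≤ P :=
  (le_add_of_nonneg_left (transpose_mul_mul_nonneg h.nonneg L)).trans h.decrease

section Decay

variable (hp : 1 ≤ p) (hP : P ≤ p • 1)
include hp hP

lemma transpose_mul_mul_le : Lᵀ * P * L ≤ (1 - p⁻¹) • P := by
  have : 0 ≤ p⁻¹ := by positivity
  calc Lᵀ * P * L ≤ P - 1 := le_sub_iff_add_le.2 h.decrease
    _ = P - p⁻¹ • (p • (1 : Matrix ι ι ℝ)) := by rw [inv_smul_smul₀ (by positivity)]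
    _ ≤ P - p⁻¹ • P := by gcongr
    _ = (1 - p⁻¹) • P := by rw [sub_smul, one_smul]

lemma transpose_pow_mul_mul_pow_le (k : ℕ) : (L ^ k)ᵀ * P * L ^ k ≤ (1 - p⁻¹) ^ k • P := by
  have hr : 0 ≤ 1 - p⁻¹ := sub_nonneg.2 (inv_le_one_of_one_le₀ hp)
  induction k with
  | zero => simp
  | succ k ih =>
    calc (L ^ (k + 1))ᵀ * P * L ^ (k + 1) = (L ^ k)ᵀ * (Lᵀ * P * L) * L ^ k := by
          rw [pow_succ', transpose_mul]
          simp only [Matrix.mul_assoc]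
      _ ≤ (L ^ k)ᵀ * ((1 - p⁻¹) • P) * L ^ k :=
          transpose_mul_mul_mono (h.transpose_mul_mul_le hp hP) _
      _ = (1 - p⁻¹) • ((L ^ k)ᵀ * P * L ^ k) := by rw [Matrix.mul_smul, Matrix.smul_mul]
      _ ≤ (1 - p⁻¹) • (1 - p⁻¹) ^ k • P := by gcongr
      _ = (1 - p⁻¹) ^ (k + 1) • P := by rw [smul_smul, pow_succ']

lemma norm_pow_le (k : ℕ) : ‖L ^ k‖ ≤ √(p * (1 - p⁻¹) ^ k) := by
  have hr : 0 ≤ 1 - p⁻¹ := sub_nonneg.2 (inv_le_one_of_one_le₀ hp)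
  rw [← transpose_mul_self_le_iff_norm_le (Real.sqrt_nonneg _), Real.sq_sqrt (by positivity)]
  calc (L ^ k)ᵀ * L ^ k = (L ^ k)ᵀ * 1 * L ^ k := by rw [Matrix.mul_one]
    _ ≤ (L ^ k)ᵀ * P * L ^ k := transpose_mul_mul_mono h.one_le _
    _ ≤ (1 - p⁻¹) ^ k • P := h.transpose_pow_mul_mul_pow_le hp hP k
    _ ≤ (1 - p⁻¹) ^ k • p • 1 := by gcongr
    _ = (p * (1 - p⁻¹) ^ k) • 1 := by rw [smul_smul, mul_comm]

end Decay

lemma tendsto_pow : Tendsto (fun k => L ^ k) atTop (𝓝 0) := by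
  let q := max 1 ‖P‖
  have hq : 1 ≤ q := le_max_left _ _
  have hPq : P ≤ q • 1 := (le_norm_smul_one (isSymm_of_nonneg h.nonneg)).trans
    (smul_le_smul_of_nonneg_right (le_max_right _ _) zero_le_one)
  have hlim : Tendsto (fun k : ℕ => √(q * (1 - q⁻¹) ^ k)) atTop (𝓝 √(q * 0)) :=
    ((tendsto_pow_atTop_nhds_zero_of_lt_one (sub_nonneg.2 (inv_le_one_of_one_le₀ hq))
      (sub_lt_self 1 (by positivity))).const_mul q).sqrt
  rw [mul_zero, Real.sqrt_zero] at hlim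
  exact squeeze_zero_norm (h.norm_pow_le hq hPq) hlim

end IsLyapunov

end Contraction

section Sylvester

variable {n : ℕ}

lemma circNorm_sum_le (ν : MatNorm) {ι : Type*} {m : ℕ} (s : Finset ι)
    (f : ι → Matrix (Fin n) (Fin m) ℝ) : circNorm ν (∑ i ∈ s, f i) ≤ ∑ i ∈ s, circNorm ν (f i) :=
  s.le_sum_of_subadditive (circNorm ν) ((circNorm_eq_zero ν).2 rfl).le (circNorm_add_le ν) f

variable {P P₁ P₂ X S L L₁ L₂ : Matrix (Fin n) (Fin n) ℝ} {p : ℝ}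

lemma circNorm_transpose_pow_mul_mul_pow_le (ν : MatNorm) (h₁ : IsLyapunov P₁ L₁)
    (h₂ : IsLyapunov P₂ L₂) (hp : 1 ≤ p) (hP₁ : P₁ ≤ p • 1) (hP₂ : P₂ ≤ p • 1)
    (Z : Matrix (Fin n) (Fin n) ℝ) (k : ℕ) :
    circNorm ν (L₁ᵀ ^ k * Z * L₂ ^ k) ≤ p * (1 - p⁻¹) ^ k * circNorm ν Z := by
  have hr : 0 ≤ 1 - p⁻¹ := sub_nonneg.2 (inv_le_one_of_one_le₀ hp)
  have hZ := circNorm_nonneg ν Z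
  calc circNorm ν (L₁ᵀ ^ k * Z * L₂ ^ k)
      ≤ opNorm (L₁ ^ k) * circNorm ν Z * opNorm (L₂ ^ k) := by
        refine (circNorm_mul_le_mul_opNorm ν _ _).trans ?_
        rw [← transpose_pow, ← opNorm_transpose (L₁ ^ k)]
        exact mul_le_mul_of_nonneg_right (circNorm_mul_le_opNorm_mul ν _ _) (opNorm_nonneg _)
    _ ≤ √(p * (1 - p⁻¹) ^ k) * circNorm ν Z * √(p * (1 - p⁻¹) ^ k) := by
        gcongr
        exacts [opNorm_nonneg _, h₁.norm_pow_le hp hP₁ k, h₂.norm_pow_le hp hP₂ k]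
    _ = p * (1 - p⁻¹) ^ k * circNorm ν Z := by
        rw [mul_right_comm, Real.mul_self_sqrt (by positivity)]

lemma circNorm_le_of_sylvester (ν : MatNorm) (h₁ : IsLyapunov P₁ L₁) (h₂ : IsLyapunov P₂ L₂)
    (hp : 1 ≤ p) (hP₁ : P₁ ≤ p • 1) (hP₂ : P₂ ≤ p • 1) (hX : X = L₁ᵀ * X * L₂ + S) :
    circNorm ν X ≤ p ^ 2 * circNorm ν S := by
  have hterm := circNorm_transpose_pow_mul_mul_pow_le ν h₁ h₂ hp hP₁ hP₂
  have hS := circNorm_nonneg ν S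
  have hN (N : ℕ) :
      circNorm ν X ≤ p * (1 - p⁻¹) ^ N * circNorm ν X + p ^ 2 * circNorm ν S :=
    calc circNorm ν X
        = circNorm ν (L₁ᵀ ^ N * X * L₂ ^ N + ∑ k ∈ Finset.range N, L₁ᵀ ^ k * S * L₂ ^ k) := by
          rw [← eq_pow_mul_mul_pow_add_sum hX N]
      _ ≤ p * (1 - p⁻¹) ^ N * circNorm ν X +
          ∑ k ∈ Finset.range N, p * (1 - p⁻¹) ^ k * circNorm ν S :=
          (circNorm_add_le ν _ _).trans <| add_le_add (hterm X N) <|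
            (circNorm_sum_le ν _ _).trans <| Finset.sum_le_sum fun k _ => hterm S k
      _ = p * (1 - p⁻¹) ^ N * circNorm ν X +
          p * (∑ k ∈ Finset.range N, (1 - p⁻¹) ^ k) * circNorm ν S := by
          rw [Finset.mul_sum, Finset.sum_mul]
      _ ≤ p * (1 - p⁻¹) ^ N * circNorm ν X + p * p * circNorm ν S := by
          gcongr
          exact sum_range_one_sub_inv_pow_le hp N
      _ = p * (1 - p⁻¹) ^ N * circNorm ν X + p ^ 2 * circNorm ν S := by rw [sq]
  have hlim : Tendsto (fun N : ℕ => p * (1 - p⁻¹) ^ N * circNorm ν X + p ^ 2 * circNorm ν S)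
      atTop (𝓝 (p * 0 * circNorm ν X + p ^ 2 * circNorm ν S)) := by
    refine (((tendsto_pow_atTop_nhds_zero_of_lt_one ?_ ?_).const_mul p).mul_const _).add_const _
    exacts [sub_nonneg.2 (inv_le_one_of_one_le₀ hp), sub_lt_self 1 (by positivity)]
  simpa using ge_of_tendsto' hlim hN

lemma IsLyapunov.exists_eq_transpose_mul_mul_add (h : IsLyapunov P L) (hp : 1 ≤ p)
    (hP : P ≤ p • 1) (S : Matrix (Fin n) (Fin n) ℝ) : ∃ X, X = Lᵀ * X * L + S := by
  let T : Module.End ℝ (Matrix (Fin n) (Fin n) ℝ) :=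
    LinearMap.id - LinearMap.mulLeft ℝ Lᵀ ∘ₗ LinearMap.mulRight ℝ L
  have hT (X : Matrix (Fin n) (Fin n) ℝ) : T X = X - Lᵀ * X * L := by
    simp [T, Matrix.mul_assoc]
  have hinj : Function.Injective T := by
    refine (injective_iff_map_eq_zero T).2 fun X hX => ?_
    have hX' : X = Lᵀ * X * L + 0 := by rwa [add_zero, ← sub_eq_zero, ← hT]
    have hle := circNorm_le_of_sylvester .op h h hp hP hP hX'
    rw [(circNorm_eq_zero .op).2 rfl, mul_zero] at hle
    exact (circNorm_eq_zero .op).1 (hle.antisymm (circNorm_nonneg _ _))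
  obtain ⟨X, hX⟩ := LinearMap.injective_iff_surjective.1 hinj S
  exact ⟨X, by rw [← hX, hT, add_sub_cancel]⟩

end Sylvester

end Lyapunov

section Stability

section SpectralRadius

variable {𝔸 : Type*} [NormedRing 𝔸] [NormedAlgebra ℂ 𝔸] [CompleteSpace 𝔸] {a : 𝔸}

lemma spectralRadius_lt_one_of_tendsto_pow (h : Tendsto (fun k => a ^ k) atTop (𝓝 0)) :
    spectralRadius ℂ a < 1 := by
  have hlim : Tendsto (fun k => ‖a ^ (k + 1)‖₊ * ‖(1 : 𝔸)‖₊) atTop (𝓝 0) := by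
    simpa using ((tendsto_add_atTop_iff_nat 1).2 h).nnnorm.mul_const ‖(1 : 𝔸)‖₊
  obtain ⟨k, hk⟩ := (hlim.eventually_lt_const one_pos).exists
  refine (spectrum.spectralRadius_le_pow_nnnorm_pow_one_div ℂ a k).trans_lt ?_
  rw [← ENNReal.mul_rpow_of_nonneg _ _ (by positivity)]
  exact ENNReal.rpow_lt_one (by exact_mod_cast hk) (by positivity)

lemma tendsto_pow_of_spectralRadius_lt_one (h : spectralRadius ℂ a < 1) :
    Tendsto (fun k => a ^ k) atTop (𝓝 0) := by
  obtain ⟨r, hr, hr1⟩ := ENNReal.lt_iff_exists_nnreal_btwn.1 h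
  have hroot :=
    (spectrum.pow_nnnorm_pow_one_div_tendsto_nhds_spectralRadius a).eventually_lt_const hr
  refine squeeze_zero_norm' ?_
    (tendsto_pow_atTop_nhds_zero_of_lt_one r.2 (ENNReal.coe_lt_one_iff.1 hr1))
  filter_upwards [hroot, eventually_ne_atTop 0] with k hk hk0
  have hpow : (‖a ^ k‖₊ : ENNReal) < (r : ENNReal) ^ k := by
    rwa [← ENNReal.rpow_natCast, ← ENNReal.rpow_inv_lt_iff (by positivity), ← one_div]
  exact_mod_cast hpow.le

end SpectralRadius

variable {n : ℕ} {L P Q : Matrix (Fin n) (Fin n) ℝ}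

lemma tendsto_map_ofReal_pow_iff :
    Tendsto (fun k => L.map (algebraMap ℝ ℂ) ^ k) atTop (𝓝 0) ↔
      Tendsto (fun k => L ^ k) atTop (𝓝 0) := by
  have hemb : Topology.IsEmbedding fun M : Matrix (Fin n) (Fin n) ℝ => M.map (algebraMap ℝ ℂ) :=
    .piMap fun _ => .piMap fun _ => Complex.isUniformEmbedding_ofReal.isEmbedding
  simp only [hemb.tendsto_nhds_iff, Function.comp_def, Matrix.map_pow,
    Matrix.map_zero _ (map_zero _)]

open scoped Matrix.Norms.L2Operator in
lemma stable_iff_tendsto_pow : Stable L ↔ Tendsto (fun k => L ^ k) atTop (𝓝 0) :=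
  Iff.trans ⟨tendsto_pow_of_spectralRadius_lt_one, spectralRadius_lt_one_of_tendsto_pow⟩
    tendsto_map_ofReal_pow_iff

lemma IsLyapunov.stable (h : IsLyapunov P L) : Stable L :=
  stable_iff_tendsto_pow.2 h.tendsto_pow

open scoped Matrix.Norms.L2Operator in
lemma Stable.exists_transpose_mul_mul_add_le (hL : Stable L) (hQ : 1 ≤ Q) :
    ∃ P, 0 ≤ P ∧ Lᵀ * P * L + Q ≤ P := by
  have hQ₀ : 0 ≤ Q := zero_le_one.trans hQ
  have hlim : Tendsto (fun N => (L ^ N)ᵀ * Q * L ^ N) atTop (𝓝 0) := by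
    have hcont : Continuous fun X : Matrix (Fin n) (Fin n) ℝ => Xᵀ * Q * X := by fun_prop
    simpa [Function.comp_def, -transpose_pow] using
      (hcont.tendsto 0).comp (stable_iff_tendsto_pow.1 hL)
  obtain ⟨N, hN⟩ := (hlim.norm.eventually_le_const (u := 2⁻¹) (by simp)).exists
  have hhalf : (2 : ℝ) • ((L ^ N)ᵀ * Q * L ^ N) ≤ Q :=
    calc (2 : ℝ) • ((L ^ N)ᵀ * Q * L ^ N) ≤ (2 : ℝ) • (2⁻¹ : ℝ) • 1 := by
          gcongr
          exact (le_norm_smul_one (isSymm_of_nonneg (transpose_mul_mul_nonneg hQ₀ _))).trans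
            (smul_le_smul_of_nonneg_right hN zero_le_one)
      _ = 1 := smul_inv_smul₀ two_ne_zero 1
      _ ≤ Q := hQ
  have htelescope : Lᵀ * (∑ k ∈ Finset.range N, (L ^ k)ᵀ * Q * L ^ k) * L + Q =
      ∑ k ∈ Finset.range N, (L ^ k)ᵀ * Q * L ^ k + (L ^ N)ᵀ * Q * L ^ N := by
    rw [← Finset.sum_range_succ, Finset.sum_range_succ', Finset.mul_sum, Finset.sum_mul]
    simp [pow_succ, Matrix.mul_assoc]
  refine ⟨(2 : ℝ) • ∑ k ∈ Finset.range N, (L ^ k)ᵀ * Q * L ^ k, ?_, ?_⟩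
  · exact smul_nonneg zero_le_two (Finset.sum_nonneg fun k _ => transpose_mul_mul_nonneg hQ₀ _)
  · rw [Matrix.mul_smul, Matrix.smul_mul, eq_sub_of_add_eq htelescope, smul_sub, smul_add,
      two_smul ℝ Q, ← sub_nonneg]
    convert sub_nonneg.2 hhalf using 1
    abel

end Stability

section Riccati

variable {ι κ : Type*} [Fintype ι]

/-- The weight `Ru + Bᵀ P B` of the input in the one-step cost with cost-to-go `P`; the Riccati
equation inverts it. -/
def inputWeight (Ru : Matrix κ κ ℝ) (B : Matrix ι κ ℝ) (P : Matrix ι ι ℝ) : Matrix κ κ ℝ :=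
  Ru + Bᵀ * P * B

variable {Rx A P Q : Matrix ι ι ℝ} {Ru : Matrix κ κ ℝ} {B : Matrix ι κ ℝ} {K : Matrix κ ι ℝ}

lemma le_inputWeight [Finite κ] (hP : 0 ≤ P) : Ru ≤ inputWeight Ru B P :=
  le_add_of_nonneg_right (transpose_mul_mul_nonneg hP B)

lemma isSymm_inputWeight [Finite κ] (hRu : 0 ≤ Ru) (hP : 0 ≤ P) : (inputWeight Ru B P).IsSymm :=
  isSymm_of_nonneg (hRu.trans (le_inputWeight hP))

variable [Fintype κ]

/-- The cost of using the controller `K` for one step, with cost-to-go `P`. -/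
def stepCost (Rx : Matrix ι ι ℝ) (Ru : Matrix κ κ ℝ) (A : Matrix ι ι ℝ) (B : Matrix ι κ ℝ)
    (K : Matrix κ ι ℝ) (P : Matrix ι ι ℝ) : Matrix ι ι ℝ :=
  (A + B * K)ᵀ * P * (A + B * K) + Kᵀ * Ru * K + Rx

lemma stepCost_mono (h : P ≤ Q) : stepCost Rx Ru A B K P ≤ stepCost Rx Ru A B K Q := by
  unfold stepCost
  gcongr
  exact transpose_mul_mul_mono h _

variable [DecidableEq κ]

/-- The controller that is greedy for the cost-to-go `P`. It is the controller `Kinf` when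
`P = Pinf`. -/
noncomputable def gain (Ru : Matrix κ κ ℝ) (A : Matrix ι ι ℝ) (B : Matrix ι κ ℝ)
    (P : Matrix ι ι ℝ) : Matrix κ ι ℝ :=
  -((inputWeight Ru B P)⁻¹ * Bᵀ * P * A)

/-- The Riccati operator, whose fixed points are the solutions of the Riccati equation. -/
noncomputable def riccati (Rx : Matrix ι ι ℝ) (Ru : Matrix κ κ ℝ) (A : Matrix ι ι ℝ)
    (B : Matrix ι κ ℝ) (P : Matrix ι ι ℝ) : Matrix ι ι ℝ :=
  Aᵀ * P * A - Aᵀ * P * B * (inputWeight Ru B P)⁻¹ * Bᵀ * P * A + Rx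

lemma isUnit_det_of_one_le {M : Matrix κ κ ℝ} (hM : 1 ≤ M) : IsUnit M.det := by
  have hpos : M.PosDef := by
    simpa using PosDef.one.add_posSemidef (le_iff.1 hM)
  exact hpos.det_pos.ne'.isUnit

lemma isUnit_det_inputWeight (hRu : 1 ≤ Ru) (hP : 0 ≤ P) : IsUnit (inputWeight Ru B P).det :=
  isUnit_det_of_one_le (hRu.trans (le_inputWeight hP))

lemma transpose_inv_inputWeight (hRu : 1 ≤ Ru) (hP : 0 ≤ P) :
    ((inputWeight Ru B P)⁻¹)ᵀ = (inputWeight Ru B P)⁻¹ := by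
  rw [transpose_nonsing_inv, (isSymm_inputWeight (zero_le_one.trans hRu) hP).eq]

lemma inputWeight_mul_gain (hRu : 1 ≤ Ru) (hP : 0 ≤ P) :
    inputWeight Ru B P * gain Ru A B P = -(Bᵀ * P * A) := by
  rw [gain, Matrix.mul_neg, Matrix.mul_assoc _ _ P, Matrix.mul_assoc _ _ A,
    mul_nonsing_inv_cancel_left _ _ (isUnit_det_inputWeight hRu hP)]

lemma gain_transpose_mul_inputWeight (hRu : 1 ≤ Ru) (hP : 0 ≤ P) :
    (gain Ru A B P)ᵀ * inputWeight Ru B P = -(Aᵀ * P * B) := by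
  have h := congrArg transpose (inputWeight_mul_gain (A := A) (B := B) hRu hP)
  rwa [transpose_mul, (isSymm_inputWeight (zero_le_one.trans hRu) hP).eq, transpose_neg,
    transpose_mul, transpose_mul, transpose_transpose, (isSymm_of_nonneg hP).eq,
    ← Matrix.mul_assoc] at h

lemma mul_gain_eq (hRu : 1 ≤ Ru) (hP : 0 ≤ P) :
    Ru * gain Ru A B P = -(Bᵀ * P * (A + B * gain Ru A B P)) := by
  have h := inputWeight_mul_gain (A := A) (B := B) hRu hP
  rw [inputWeight, Matrix.add_mul] at h
  rw [eq_sub_of_add_eq h, Matrix.mul_add, Matrix.mul_assoc (Bᵀ * P)]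
  abel

lemma gain_transpose_mul_eq (hRu : 1 ≤ Ru) (hP : 0 ≤ P) :
    (gain Ru A B P)ᵀ * Ru = -((A + B * gain Ru A B P)ᵀ * P * B) := by
  have h := congrArg transpose (mul_gain_eq (A := A) (B := B) hRu hP)
  rwa [transpose_mul, (isSymm_of_nonneg (zero_le_one.trans hRu)).eq, transpose_neg, transpose_mul,
    transpose_mul, transpose_transpose, (isSymm_of_nonneg hP).eq, ← Matrix.mul_assoc] at h

/-- Completion of the square in `K`. -/
lemma stepCost_eq_riccati_add (hRu : 1 ≤ Ru) (hP : 0 ≤ P) :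
    stepCost Rx Ru A B K P = riccati Rx Ru A B P +
      (K - gain Ru A B P)ᵀ * inputWeight Ru B P * (K - gain Ru A B P) := by
  have hriccati : riccati Rx Ru A B P = Aᵀ * P * A + Aᵀ * P * B * gain Ru A B P + Rx := by
    simp only [riccati, gain, Matrix.mul_neg, Matrix.mul_assoc, sub_eq_add_neg]
  have hsquare : (K - gain Ru A B P)ᵀ * inputWeight Ru B P * (K - gain Ru A B P) =
      Kᵀ * inputWeight Ru B P * K + Kᵀ * (Bᵀ * P * A) + Aᵀ * P * B * K
        - Aᵀ * P * B * gain Ru A B P := by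
    rw [transpose_sub, Matrix.sub_mul, gain_transpose_mul_inputWeight hRu hP, Matrix.mul_sub,
      Matrix.sub_mul, Matrix.sub_mul, Matrix.mul_assoc Kᵀ _ (gain Ru A B P),
      inputWeight_mul_gain hRu hP]
    simp only [Matrix.mul_neg, Matrix.neg_mul]
    abel
  rw [hriccati, hsquare]
  simp only [stepCost, inputWeight, transpose_add, transpose_mul, Matrix.mul_add, Matrix.add_mul,
    Matrix.mul_assoc]
  abel

lemma riccati_eq_stepCost_gain (hRu : 1 ≤ Ru) (hP : 0 ≤ P) :
    riccati Rx Ru A B P = stepCost Rx Ru A B (gain Ru A B P) P := by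
  simp [stepCost_eq_riccati_add hRu hP]

lemma riccati_le_stepCost (hRu : 1 ≤ Ru) (hP : 0 ≤ P) :
    riccati Rx Ru A B P ≤ stepCost Rx Ru A B K P := by
  rw [stepCost_eq_riccati_add hRu hP]
  exact le_add_of_nonneg_right <| transpose_mul_mul_nonneg
    (zero_le_one.trans (hRu.trans (le_inputWeight hP))) _

lemma riccati_mono (hRu : 1 ≤ Ru) (hP : 0 ≤ P) (h : P ≤ Q) :
    riccati Rx Ru A B P ≤ riccati Rx Ru A B Q := by
  rw [riccati_eq_stepCost_gain hRu (hP.trans h)]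
  exact (riccati_le_stepCost hRu hP).trans (stepCost_mono h)

lemma le_riccati (hRu : 1 ≤ Ru) (hP : 0 ≤ P) : Rx ≤ riccati Rx Ru A B P := by
  simpa [riccati] using riccati_mono (Rx := Rx) (A := A) (B := B) hRu le_rfl hP

open scoped Matrix.Norms.L2Operator in
lemma continuousAt_riccati (hRu : 1 ≤ Ru) (hP : 0 ≤ P) :
    ContinuousAt (riccati Rx Ru A B) P := by
  have hinv : ContinuousAt (fun Q => (inputWeight Ru B Q)⁻¹) P := by
    refine ContinuousAt.comp (f := inputWeight Ru B) (g := Inv.inv) (continuousAt_matrix_inv _ ?_)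
      (by unfold inputWeight; fun_prop)
    exact NormedRing.inverse_continuousAt (isUnit_det_inputWeight hRu hP).unit
  unfold riccati
  fun_prop

lemma exists_riccati_eq_self (hRx : 0 ≤ Rx) (hRu : 1 ≤ Ru) (hQ : 0 ≤ Q)
    (h : stepCost Rx Ru A B K Q ≤ Q) : ∃ P, 0 ≤ P ∧ riccati Rx Ru A B P = P := by
  let u : ℕ → Matrix ι ι ℝ := fun k => (riccati Rx Ru A B)^[k] 0
  have hsucc (k : ℕ) : u (k + 1) = riccati Rx Ru A B (u k) := Function.iterate_succ_apply' _ _ _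
  have hu (k : ℕ) : 0 ≤ u k := by
    induction k with
    | zero => exact le_rfl
    | succ k ih => exact (hRx.trans (le_riccati hRu ih)).trans_eq (hsucc k).symm
  have hmono : Monotone u := monotone_nat_of_le_succ fun k => by
    induction k with
    | zero => exact hu 1
    | succ k ih =>
      rw [hsucc, hsucc (k + 1)]
      exact riccati_mono hRu (hu k) ih
  have hle (k : ℕ) : u k ≤ Q := by
    induction k with
    | zero => exact hQ
    | succ k ih =>
      rw [hsucc]
      exact (riccati_le_stepCost hRu (hu k)).trans ((stepCost_mono ih).trans h)
  obtain ⟨P, hP, hlim⟩ := exists_tendsto_of_monotone_of_mem_compact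
    hmono isCompact_Icc fun k => ⟨hu k, hle k⟩
  refine ⟨P, hP.1, tendsto_nhds_unique ?_ ((tendsto_add_atTop_iff_nat 1).2 hlim)⟩
  simp only [hsucc]
  exact (continuousAt_riccati hRu hP.1).tendsto.comp hlim

variable [DecidableEq ι]

lemma le_of_riccati_eq_self_of_stepCost_le (hRu : 1 ≤ Ru) (hP : 0 ≤ P)
    (hfix : riccati Rx Ru A B P = P) (hK : Tendsto (fun k => (A + B * K) ^ k) atTop (𝓝 0))
    (hQ : stepCost Rx Ru A B K Q ≤ Q) : P ≤ Q := by
  have hstep : P - Q ≤ (A + B * K)ᵀ * (P - Q) * (A + B * K) :=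
    calc P - Q ≤ stepCost Rx Ru A B K P - stepCost Rx Ru A B K Q := by
          gcongr
          exact hfix.symm.trans_le (riccati_le_stepCost hRu hP)
      _ = (A + B * K)ᵀ * (P - Q) * (A + B * K) := by
          rw [stepCost, stepCost, add_sub_add_right_eq_sub, add_sub_add_right_eq_sub,
            Matrix.mul_sub, Matrix.sub_mul]
  have hiter (k : ℕ) : P - Q ≤ ((A + B * K) ^ k)ᵀ * (P - Q) * (A + B * K) ^ k := by
    induction k with
    | zero => simp
    | succ k ih =>
      refine hstep.trans ((transpose_mul_mul_mono ih _).trans_eq ?_)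
      rw [pow_succ, transpose_mul]
      simp only [Matrix.mul_assoc]
  have hcont : Continuous fun X : Matrix ι ι ℝ => Xᵀ * (P - Q) * X := by fun_prop
  have hlim : Tendsto (fun k => ((A + B * K) ^ k)ᵀ * (P - Q) * (A + B * K) ^ k) atTop (𝓝 0) := by
    simpa [Function.comp_def, -transpose_pow] using (hcont.tendsto 0).comp hK
  exact sub_nonpos.1 (ge_of_tendsto' hlim hiter)

end Riccati

section InputWeightInverse

open scoped Matrix.Norms.L2Operator

variable {ι κ : Type*} [Fintype ι] [Fintype κ] [DecidableEq ι] [DecidableEq κ]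
  {P : Matrix ι ι ℝ} {Ru : Matrix κ κ ℝ} {B : Matrix ι κ ℝ}

lemma transpose_mul_self_add_le_inv_inputWeight (hRu : 1 ≤ Ru) (hP : 1 ≤ P) :
    ((inputWeight Ru B P)⁻¹)ᵀ * (inputWeight Ru B P)⁻¹ +
      (B * (inputWeight Ru B P)⁻¹)ᵀ * (B * (inputWeight Ru B P)⁻¹) ≤ (inputWeight Ru B P)⁻¹ := by
  have hP₀ : 0 ≤ P := zero_le_one.trans hP
  have hle : 1 + Bᵀ * B ≤ inputWeight Ru B P :=
    add_le_add hRu (by simpa using transpose_mul_mul_mono hP B)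
  have hconj := transpose_mul_mul_mono hle (inputWeight Ru B P)⁻¹
  rw [transpose_inv_inputWeight hRu hP₀,
    nonsing_inv_mul _ (isUnit_det_inputWeight hRu hP₀), Matrix.one_mul] at hconj
  simpa only [Matrix.mul_add, Matrix.add_mul, Matrix.mul_one, transpose_mul, Matrix.mul_assoc,
    transpose_inv_inputWeight hRu hP₀] using hconj

lemma norm_inv_inputWeight_le (hRu : 1 ≤ Ru) (hP : 1 ≤ P) : ‖(inputWeight Ru B P)⁻¹‖ ≤ 1 :=
  norm_le_one_of_transpose_mul_self_le <|
    (le_add_of_nonneg_right (transpose_mul_self_nonneg _)).trans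
      (transpose_mul_self_add_le_inv_inputWeight hRu hP)

lemma transpose_mul_self_le_inv_inputWeight (hRu : 1 ≤ Ru) (hP : 1 ≤ P) :
    (B * (inputWeight Ru B P)⁻¹)ᵀ * (B * (inputWeight Ru B P)⁻¹) ≤ (inputWeight Ru B P)⁻¹ :=
  (le_add_of_nonneg_left (transpose_mul_self_nonneg _)).trans
    (transpose_mul_self_add_le_inv_inputWeight hRu hP)

lemma norm_mul_inv_inputWeight_le (hRu : 1 ≤ Ru) (hP : 1 ≤ P) :
    ‖B * (inputWeight Ru B P)⁻¹‖ ≤ 1 := by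
  have hle := norm_le_norm_of_nonneg_of_le (transpose_mul_self_nonneg _)
    (transpose_mul_self_le_inv_inputWeight (B := B) hRu hP)
  rw [norm_transpose_mul_self] at hle
  exact (sq_le_one_iff₀ (norm_nonneg _)).1 (hle.trans (norm_inv_inputWeight_le hRu hP))

lemma norm_mul_inv_inputWeight_mul_transpose_le (hRu : 1 ≤ Ru) (hP : 1 ≤ P) :
    ‖B * (inputWeight Ru B P)⁻¹ * Bᵀ‖ ≤ 1 := by
  refine norm_le_one_of_transpose_mul_self_le ?_
  have hle := transpose_mul_mul_mono (transpose_mul_self_le_inv_inputWeight (B := B) hRu hP) Bᵀ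
  simpa only [transpose_mul, transpose_transpose, Matrix.mul_assoc] using hle

end InputWeightInverse

section OptimalLoop

variable {n m : ℕ}

/-- The controller `K` is optimal for `(A, B)` and the cost `Rx, Ru ≥ 1`, with cost-to-go `P` and
closed loop matrix `L`, and `p` bounds the norm of `P`. Both `K` and `L` are determined by `P`. -/
structure IsOptimalLoop (Rx : Matrix (Fin n) (Fin n) ℝ) (Ru : Matrix (Fin m) (Fin m) ℝ)
    (A : Matrix (Fin n) (Fin n) ℝ) (B : Matrix (Fin n) (Fin m) ℝ) (P : Matrix (Fin n) (Fin n) ℝ)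
    (K : Matrix (Fin m) (Fin n) ℝ) (L : Matrix (Fin n) (Fin n) ℝ) (p : ℝ) : Prop where
  one_le_Rx : 1 ≤ Rx
  one_le_Ru : 1 ≤ Ru
  one_le_bound : 1 ≤ p
  isDARESolution : IsDARESolution Rx Ru A B P
  opNorm_le : opNorm P ≤ p
  gain_eq : K = gain Ru A B P
  closedLoop_eq : L = A + B * K

variable {Rx A P L : Matrix (Fin n) (Fin n) ℝ} {Ru : Matrix (Fin m) (Fin m) ℝ}
  {B : Matrix (Fin n) (Fin m) ℝ} {K : Matrix (Fin m) (Fin n) ℝ} {p : ℝ}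

lemma IsDARESolution.nonneg (h : IsDARESolution Rx Ru A B P) : 0 ≤ P := h.1.nonneg

lemma IsDARESolution.riccati_eq (h : IsDARESolution Rx Ru A B P) : riccati Rx Ru A B P = P :=
  h.2.symm

lemma IsDARESolution.one_le (h : IsDARESolution Rx Ru A B P) (hRx : 1 ≤ Rx) (hRu : 1 ≤ Ru) :
    1 ≤ P :=
  hRx.trans ((le_riccati hRu h.nonneg).trans_eq h.riccati_eq)

namespace IsOptimalLoop

variable (h : IsOptimalLoop Rx Ru A B P K L p)
include h

lemma nonneg : 0 ≤ P := h.isDARESolution.nonneg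

lemma one_le : 1 ≤ P := h.isDARESolution.one_le h.one_le_Rx h.one_le_Ru

lemma isSymm : P.IsSymm := isSymm_of_nonneg h.nonneg

lemma bound_nonneg : 0 ≤ p := zero_le_one.trans h.one_le_bound

lemma le_smul_one : P ≤ p • 1 :=
  (le_norm_smul_one h.isSymm).trans (smul_le_smul_of_nonneg_right h.opNorm_le zero_le_one)

lemma eq_stepCost : P = Lᵀ * P * L + Kᵀ * Ru * K + Rx := by
  have hcost := riccati_eq_stepCost_gain (Rx := Rx) (A := A) (B := B) h.one_le_Ru h.nonneg
  rwa [h.isDARESolution.riccati_eq, ← h.gain_eq, stepCost, ← h.closedLoop_eq] at hcost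

lemma mul_gain_eq : Ru * K = -(Bᵀ * P * L) := by
  rw [h.closedLoop_eq, h.gain_eq]
  exact LQR.mul_gain_eq h.one_le_Ru h.nonneg

lemma gain_transpose_mul_eq : Kᵀ * Ru = -(Lᵀ * P * B) := by
  rw [h.closedLoop_eq, h.gain_eq]
  exact LQR.gain_transpose_mul_eq h.one_le_Ru h.nonneg

lemma transpose_mul_weight_mul_nonneg : 0 ≤ Kᵀ * Ru * K :=
  transpose_mul_mul_nonneg (zero_le_one.trans h.one_le_Ru) K

lemma isLyapunov : IsLyapunov P L where
  nonneg := h.nonneg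
  decrease := by
    conv_rhs => rw [h.eq_stepCost]
    rw [add_assoc]
    gcongr
    exact h.one_le_Rx.trans (le_add_of_nonneg_left h.transpose_mul_weight_mul_nonneg)

lemma opNorm_le_of_transpose_mul_self_le {k : ℕ} {C : Matrix (Fin k) (Fin n) ℝ} (hC : Cᵀ * C ≤ P) :
    opNorm C ≤ p :=
  (transpose_mul_self_le_iff_norm_le h.bound_nonneg).1 <| hC.trans <| h.le_smul_one.trans <|
    smul_le_smul_of_nonneg_right (le_self_pow₀ h.one_le_bound two_ne_zero) zero_le_one

lemma opNorm_gain_le : opNorm K ≤ p := by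
  refine h.opNorm_le_of_transpose_mul_self_le ?_
  calc Kᵀ * K = Kᵀ * 1 * K := by rw [Matrix.mul_one]
    _ ≤ Kᵀ * Ru * K := transpose_mul_mul_mono h.one_le_Ru K
    _ ≤ Lᵀ * P * L + Kᵀ * Ru * K := le_add_of_nonneg_left (transpose_mul_mul_nonneg h.nonneg L)
    _ ≤ Lᵀ * P * L + Kᵀ * Ru * K + Rx := le_add_of_nonneg_right (zero_le_one.trans h.one_le_Rx)
    _ = P := h.eq_stepCost.symm

lemma opNorm_closedLoop_le : opNorm L ≤ p := by
  refine h.opNorm_le_of_transpose_mul_self_le ?_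
  calc Lᵀ * L = Lᵀ * 1 * L := by rw [Matrix.mul_one]
    _ ≤ Lᵀ * P * L := transpose_mul_mul_mono h.one_le L
    _ ≤ Lᵀ * P * L + 1 := le_add_of_nonneg_right zero_le_one
    _ ≤ P := h.isLyapunov.decrease

lemma opNorm_closedLoop_transpose_le : opNorm Lᵀ ≤ p :=
  (opNorm_transpose L).trans_le h.opNorm_closedLoop_le

/-- The Riccati equation can be tested against any controller `K₂`, since the derivative of the
one-step cost at the optimal controller vanishes. -/
lemma eq_mixed_stepCost (K₂ : Matrix (Fin m) (Fin n) ℝ) :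
    P = Lᵀ * P * (A + B * K₂) + Kᵀ * Ru * K₂ + Rx := by
  have htest (K₃ : Matrix (Fin m) (Fin n) ℝ) :
      Lᵀ * P * (A + B * K₃) + Kᵀ * Ru * K₃ = Lᵀ * P * A := by
    rw [h.gain_transpose_mul_eq, Matrix.mul_add, Matrix.neg_mul, Matrix.mul_assoc (Lᵀ * P) B K₃,
      add_neg_cancel_right]
  rw [htest, ← htest K, ← h.closedLoop_eq]
  exact h.eq_stepCost

lemma eq_mixed_stepCost_transpose (K₂ : Matrix (Fin m) (Fin n) ℝ) :
    P = (A + B * K₂)ᵀ * P * L + K₂ᵀ * Ru * K + Rx := by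
  have hRu := isSymm_of_nonneg (zero_le_one.trans h.one_le_Ru)
  have hRx := isSymm_of_nonneg (zero_le_one.trans h.one_le_Rx)
  have hmixed := congrArg transpose (h.eq_mixed_stepCost K₂)
  simpa only [transpose_add, transpose_mul, transpose_transpose, h.isSymm.eq, hRu.eq, hRx.eq,
    Matrix.mul_assoc] using hmixed

lemma circNorm_inv_mul_add_le (ν : MatNorm) (U : Matrix (Fin m) (Fin n) ℝ)
    (V : Matrix (Fin n) (Fin n) ℝ) :
    circNorm ν ((inputWeight Ru B P)⁻¹ * (U + Bᵀ * V)) ≤ circNorm ν U + circNorm ν V := by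
  have hNB : opNorm ((inputWeight Ru B P)⁻¹ * Bᵀ) ≤ 1 := by
    rw [← opNorm_transpose, transpose_mul, transpose_transpose,
      transpose_inv_inputWeight h.one_le_Ru h.nonneg]
    exact norm_mul_inv_inputWeight_le h.one_le_Ru h.one_le
  rw [Matrix.mul_add, ← Matrix.mul_assoc]
  simpa using circNorm_add_le_of_le
    (circNorm_mul_le_of_opNorm_le_left (norm_inv_inputWeight_le h.one_le_Ru h.one_le) le_rfl)
    (circNorm_mul_le_of_opNorm_le_left hNB le_rfl)

lemma circNorm_mul_inv_mul_add_le (ν : MatNorm) (U : Matrix (Fin m) (Fin n) ℝ)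
    (V : Matrix (Fin n) (Fin n) ℝ) :
    circNorm ν (B * ((inputWeight Ru B P)⁻¹ * (U + Bᵀ * V))) ≤ circNorm ν U + circNorm ν V := by
  rw [Matrix.mul_add, Matrix.mul_add, ← Matrix.mul_assoc, ← Matrix.mul_assoc, ← Matrix.mul_assoc]
  simpa using circNorm_add_le_of_le
    (circNorm_mul_le_of_opNorm_le_left (norm_mul_inv_inputWeight_le h.one_le_Ru h.one_le) le_rfl)
    (circNorm_mul_le_of_opNorm_le_left
      (norm_mul_inv_inputWeight_mul_transpose_le h.one_le_Ru h.one_le) le_rfl)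

end IsOptimalLoop

end OptimalLoop

section Existence

variable {n m : ℕ} {Rx A : Matrix (Fin n) (Fin n) ℝ} {Ru : Matrix (Fin m) (Fin m) ℝ}
  {B : Matrix (Fin n) (Fin m) ℝ} {p : ℝ}

lemma Stabilizable.exists_isDARESolution (hRx : 1 ≤ Rx) (hRu : 1 ≤ Ru) (h : Stabilizable A B) :
    ∃ P, IsDARESolution Rx Ru A B P := by
  obtain ⟨K, hK⟩ := h
  have hRK : 0 ≤ Kᵀ * Ru * K := transpose_mul_mul_nonneg (zero_le_one.trans hRu) K
  obtain ⟨Q, hQ, hKQ⟩ := hK.exists_transpose_mul_mul_add_le (Q := Kᵀ * Ru * K + Rx)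
    (hRx.trans (le_add_of_nonneg_left hRK))
  rw [← add_assoc] at hKQ
  obtain ⟨P, hP, hfix⟩ := exists_riccati_eq_self (zero_le_one.trans hRx) hRu hQ hKQ
  exact ⟨P, hP.posSemidef, hfix.symm⟩

lemma Stabilizable.isDARESolution_Pinf (hRx : 1 ≤ Rx) (hRu : 1 ≤ Ru) (h : Stabilizable A B) :
    IsDARESolution Rx Ru A B (Pinf Rx Ru A B) := by
  have hex := h.exists_isDARESolution hRx hRu
  rw [Pinf, dif_pos hex]
  exact hex.choose_spec

lemma Stabilizable.isOptimalLoop (hRx : 1 ≤ Rx) (hRu : 1 ≤ Ru) (h : Stabilizable A B)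
    (hp : 1 ≤ p) (hPp : opNorm (Pinf Rx Ru A B) ≤ p) :
    IsOptimalLoop Rx Ru A B (Pinf Rx Ru A B) (Kinf Rx Ru A B) (A + B * Kinf Rx Ru A B) p :=
  ⟨hRx, hRu, hp, h.isDARESolution_Pinf hRx hRu, hPp, rfl, rfl⟩

open scoped Matrix.Norms.L2Operator in
lemma Stabilizable.one_le_opNorm_Pinf [NeZero n] (hRx : 1 ≤ Rx) (hRu : 1 ≤ Ru)
    (h : Stabilizable A B) : 1 ≤ opNorm (Pinf Rx Ru A B) := by
  have hone := norm_le_norm_of_nonneg_of_le (zero_le_one (α := Matrix (Fin n) (Fin n) ℝ))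
    ((h.isDARESolution_Pinf hRx hRu).one_le hRx hRu)
  rwa [norm_one] at hone

end Existence

section Perturbation

variable {n m : ℕ} {ν : MatNorm}

/-- The difference of the closed loop matrices of `(A₁, B₁)` and `(A, B)` under the same
controller `K`. -/
def drift (A A₁ : Matrix (Fin n) (Fin n) ℝ) (B B₁ : Matrix (Fin n) (Fin m) ℝ)
    (K : Matrix (Fin m) (Fin n) ℝ) : Matrix (Fin n) (Fin n) ℝ :=
  A₁ - A + (B₁ - B) * K

variable {Rx A A₁ P P₁ L : Matrix (Fin n) (Fin n) ℝ} {Ru : Matrix (Fin m) (Fin m) ℝ}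
  {B B₁ : Matrix (Fin n) (Fin m) ℝ} {K : Matrix (Fin m) (Fin n) ℝ} {p : ℝ}

lemma add_drift : A + B * K + drift A A₁ B B₁ K = A₁ + B₁ * K := by
  rw [drift, Matrix.sub_mul]
  abel

variable (ν A A₁ B B₁) in
lemma circNorm_drift_le (hp : 1 ≤ p) (hK : opNorm K ≤ p) :
    circNorm ν (drift A A₁ B B₁ K) ≤ 2 * p * modelErr ν A A₁ B B₁ := by
  have herr := modelErr_nonneg ν A A₁ B B₁
  calc circNorm ν (drift A A₁ B B₁ K) ≤ modelErr ν A A₁ B B₁ + modelErr ν A A₁ B B₁ * p :=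
        circNorm_add_le_of_le (circNorm_sub_le_modelErr_left ν A A₁ B B₁)
          (circNorm_mul_le_of_opNorm_le_right (circNorm_sub_le_modelErr_right ν A A₁ B B₁) hK)
    _ ≤ 2 * p * modelErr ν A A₁ B B₁ := by nlinarith

namespace IsOptimalLoop

variable (h : IsOptimalLoop Rx Ru A B P K L p) (hsafe : 54 * p ^ 5 * modelErr .op A A₁ B B₁ ≤ 1)
include h hsafe

open scoped Matrix.Norms.L2Operator in
lemma norm_perturbation_le :
    ‖Lᵀ * P * drift A A₁ B B₁ K + (drift A A₁ B B₁ K)ᵀ * P * L +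
      (drift A A₁ B B₁ K)ᵀ * P * drift A A₁ B B₁ K‖ ≤ 1 / 2 := by
  set e := modelErr .op A A₁ B B₁
  have he : 0 ≤ e := modelErr_nonneg _ _ _ _ _
  have hp := h.one_le_bound
  have := h.bound_nonneg
  have hD : circNorm .op (drift A A₁ B B₁ K) ≤ 2 * p * e :=
    circNorm_drift_le .op A A₁ B B₁ hp h.opNorm_gain_le
  have hPL := circNorm_mul_le_of_opNorm_le_right (circNorm_transpose_le hD) h.opNorm_le
  have hbound := circNorm_add_le_of_le (circNorm_add_le_of_le
    (circNorm_mul_le_of_opNorm_le_left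
      (circNorm_mul_le_of_opNorm_le_left (ν := .op) h.opNorm_closedLoop_transpose_le
        h.opNorm_le) hD)
    (circNorm_mul_le_of_opNorm_le_right hPL h.opNorm_closedLoop_le))
    (circNorm_mul_le_of_opNorm_le_right hPL hD)
  have hcube : p ^ 3 * e ≤ p ^ 5 * e := by gcongr; norm_num
  have hone : e ≤ p ^ 5 * e := le_mul_of_one_le_left he (one_le_pow₀ hp)
  have hsq : p ^ 3 * e * e ≤ 1 / 54 * (1 / 54) :=
    mul_le_mul (by linarith) (by linarith) he (by norm_num)
  refine hbound.trans ?_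
  nlinarith

/-- Doubling the cost-to-go absorbs the perturbation of the closed loop. -/
lemma stepCost_two_smul_le : stepCost Rx Ru A₁ B₁ K ((2 : ℝ) • P) ≤ (2 : ℝ) • P := by
  set D := drift A A₁ B B₁ K
  set Z := Lᵀ * P * D + Dᵀ * P * L + Dᵀ * P * D with hZ_def
  have hexpand : (A₁ + B₁ * K)ᵀ * P * (A₁ + B₁ * K) = Lᵀ * P * L + Z := by
    rw [← add_drift (A := A) (B := B), ← h.closedLoop_eq, hZ_def]
    simp only [transpose_add, Matrix.add_mul, Matrix.mul_add]
    abel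
  have hZ_symm : Z.IsSymm := by
    simp only [hZ_def, IsSymm, transpose_add, transpose_mul, transpose_transpose, h.isSymm.eq,
      Matrix.mul_assoc]
    abel
  have hZ : (2 : ℝ) • Z ≤ Kᵀ * Ru * K + Rx :=
    calc (2 : ℝ) • Z ≤ (2 : ℝ) • (1 / 2 : ℝ) • 1 := by
          gcongr
          exact (le_norm_smul_one hZ_symm).trans
            (smul_le_smul_of_nonneg_right (h.norm_perturbation_le hsafe) zero_le_one)
      _ = 1 := by rw [smul_smul]; norm_num
      _ ≤ Rx := h.one_le_Rx
      _ ≤ Kᵀ * Ru * K + Rx := le_add_of_nonneg_left h.transpose_mul_weight_mul_nonneg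
  calc stepCost Rx Ru A₁ B₁ K ((2 : ℝ) • P)
      = (2 : ℝ) • (Lᵀ * P * L) + (2 : ℝ) • Z + (Kᵀ * Ru * K + Rx) := by
        rw [stepCost, Matrix.mul_smul, Matrix.smul_mul, hexpand, smul_add, add_assoc _ _ Rx]
    _ ≤ (2 : ℝ) • (Lᵀ * P * L) + (Kᵀ * Ru * K + Rx) + (Kᵀ * Ru * K + Rx) := by gcongr
    _ = (2 : ℝ) • (Lᵀ * P * L + Kᵀ * Ru * K + Rx) := by
        simp only [two_smul]
        abel
    _ = (2 : ℝ) • P := by rw [← h.eq_stepCost]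

lemma isLyapunov_perturbed : IsLyapunov ((2 : ℝ) • P) (A₁ + B₁ * K) where
  nonneg := smul_nonneg zero_le_two h.nonneg
  decrease := by
    refine le_trans ?_ (h.stepCost_two_smul_le hsafe)
    rw [stepCost, add_assoc]
    gcongr
    exact h.one_le_Rx.trans (le_add_of_nonneg_left h.transpose_mul_weight_mul_nonneg)

lemma stabilizable_perturbed : Stabilizable A₁ B₁ :=
  ⟨K, (h.isLyapunov_perturbed hsafe).stable⟩

lemma opNorm_perturbed_le (h₁ : IsDARESolution Rx Ru A₁ B₁ P₁) : opNorm P₁ ≤ 2 * p := by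
  refine norm_le_of_nonneg_of_le_smul_one (mul_nonneg zero_le_two h.bound_nonneg) h₁.nonneg ?_
  calc P₁ ≤ (2 : ℝ) • P := le_of_riccati_eq_self_of_stepCost_le h.one_le_Ru h₁.nonneg
        h₁.riccati_eq (h.isLyapunov_perturbed hsafe).tendsto_pow (h.stepCost_two_smul_le hsafe)
    _ ≤ (2 : ℝ) • p • 1 := by
        gcongr
        exact h.le_smul_one
    _ = (2 * p) • 1 := smul_smul 2 p 1

end IsOptimalLoop

end Perturbation

section Expansion

variable {n m : ℕ} {ν : MatNorm}

/-- The derivative of `gain` along the segment from `(A, B)` to `(A₁, B₁)`, in terms of the drift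
`D`, the closed loop matrix `L` and the derivative `Pd` of the cost-to-go `P`. -/
noncomputable def gainDeriv (Ru : Matrix (Fin m) (Fin m) ℝ) (B B₁ : Matrix (Fin n) (Fin m) ℝ)
    (P L D Pd : Matrix (Fin n) (Fin n) ℝ) : Matrix (Fin m) (Fin n) ℝ :=
  -((inputWeight Ru B P)⁻¹ * ((B₁ - B)ᵀ * (P * L) + Bᵀ * (Pd * L + P * D)))

variable {Rx A A₁ P P₁ L L₁ Pd : Matrix (Fin n) (Fin n) ℝ} {Ru : Matrix (Fin m) (Fin m) ℝ}
  {B B₁ : Matrix (Fin n) (Fin m) ℝ} {K K₁ : Matrix (Fin m) (Fin n) ℝ} {p : ℝ}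

lemma drift_add_smul_sub (t : ℝ) :
    drift A (A + t • (A₁ - A)) B (B + t • (B₁ - B)) K = t • drift A A₁ B B₁ K := by
  simp only [drift, add_sub_cancel_left, smul_add, Matrix.smul_mul]

lemma drift_sub_drift :
    drift A A₁ B B₁ K₁ - drift A A₁ B B₁ K = (B₁ - B) * (K₁ - K) := by
  rw [drift, drift, add_sub_add_left_eq_sub, Matrix.mul_sub]

lemma gainDeriv_add_smul_sub (t : ℝ) (D : Matrix (Fin n) (Fin n) ℝ) :
    gainDeriv Ru B (B + t • (B₁ - B)) P L (t • D) (t • Pd) = t • gainDeriv Ru B B₁ P L D Pd := by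
  simp only [gainDeriv, add_sub_cancel_left, transpose_smul, Matrix.smul_mul, Matrix.mul_smul,
    smul_neg, ← smul_add]

namespace IsOptimalLoop

section Identities

variable (h : IsOptimalLoop Rx Ru A B P K L p) {p₁ : ℝ}
  (h₁ : IsOptimalLoop Rx Ru A₁ B₁ P₁ K₁ L₁ p₁)
include h h₁

lemma closedLoop_sub_eq : L₁ - L = drift A A₁ B B₁ K₁ + B * (K₁ - K) := by
  rw [h₁.closedLoop_eq, h.closedLoop_eq, drift, Matrix.sub_mul, Matrix.mul_sub]
  abel

/-- Each Riccati equation is tested against the optimal controller of the other system, so that the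
terms quadratic in the controllers cancel. -/
lemma costToGo_sub_eq :
    P₁ - P = L₁ᵀ * (P₁ - P) * L +
      (L₁ᵀ * P₁ * drift A A₁ B B₁ K + (drift A A₁ B B₁ K₁)ᵀ * P * L) := by
  have hL : A₁ + B₁ * K = L + drift A A₁ B B₁ K := by
    rw [h.closedLoop_eq, add_drift]
  have hL₁ : A + B * K₁ = L₁ - drift A A₁ B B₁ K₁ := by
    rw [h₁.closedLoop_eq, eq_sub_iff_add_eq, add_drift]
  conv_lhs => rw [h₁.eq_mixed_stepCost K, h.eq_mixed_stepCost_transpose K₁, hL, hL₁]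
  simp only [transpose_sub, Matrix.mul_add, Matrix.sub_mul, Matrix.mul_sub]
  abel

lemma gain_sub_eq :
    K₁ - K = -((inputWeight Ru B P)⁻¹ *
      ((B₁ - B)ᵀ * (P₁ * L₁) + Bᵀ * ((P₁ - P) * L₁ + P * drift A A₁ B B₁ K₁))) := by
  have hL : L = L₁ - (drift A A₁ B B₁ K₁ + B * (K₁ - K)) := by
    rw [← h.closedLoop_sub_eq h₁, sub_sub_cancel]
  have hweight : inputWeight Ru B P * (K₁ - K) =
      -((B₁ - B)ᵀ * (P₁ * L₁) + Bᵀ * ((P₁ - P) * L₁ + P * drift A A₁ B B₁ K₁)) := by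
    rw [inputWeight, Matrix.add_mul, Matrix.mul_sub Ru, h₁.mul_gain_eq, h.mul_gain_eq]
    conv_lhs => enter [1, 2]; rw [hL]
    simp only [transpose_sub, Matrix.mul_add, Matrix.sub_mul, Matrix.mul_sub, Matrix.mul_assoc]
    abel
  rw [← Matrix.mul_neg, ← hweight,
    nonsing_inv_mul_cancel_left _ _ (isUnit_det_inputWeight h.one_le_Ru h.nonneg)]

lemma gain_sub_sub_gainDeriv_eq :
    K₁ - K - gainDeriv Ru B B₁ P L (drift A A₁ B B₁ K) Pd =
      -((inputWeight Ru B P)⁻¹ * ((B₁ - B)ᵀ * ((P₁ - P) * L₁ + P * (L₁ - L)) +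
        Bᵀ * ((P₁ - P - Pd) * L + (P₁ - P) * (L₁ - L) + P * ((B₁ - B) * (K₁ - K))))) := by
  have hdrift := drift_sub_drift (A := A) (A₁ := A₁) (B := B) (B₁ := B₁) (K := K) (K₁ := K₁)
  rw [← hdrift]
  conv_lhs => rw [h.gain_sub_eq h₁, gainDeriv]
  rw [neg_sub_neg, ← Matrix.mul_sub, ← Matrix.mul_neg]
  congr 1
  simp only [Matrix.mul_add, Matrix.sub_mul, Matrix.mul_sub]
  abel

end Identities
section Bounds

variable (h : IsOptimalLoop Rx Ru A B P K L p) (h₁ : IsOptimalLoop Rx Ru A₁ B₁ P₁ K₁ L₁ p)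
include h h₁

lemma circNorm_costToGo_sub_le : circNorm ν (P₁ - P) ≤ 4 * p ^ 5 * modelErr ν A A₁ B B₁ := by
  have hD := circNorm_drift_le ν A A₁ B B₁ h.one_le_bound h.opNorm_gain_le
  have hD₁ := circNorm_drift_le ν A A₁ B B₁ h₁.one_le_bound h₁.opNorm_gain_le
  have hS := circNorm_add_le_of_le
    (circNorm_mul_le_of_opNorm_le_left (circNorm_mul_le_of_opNorm_le_left (ν := .op)
      h₁.opNorm_closedLoop_transpose_le h₁.opNorm_le) hD)
    (circNorm_mul_le_of_opNorm_le_right (circNorm_mul_le_of_opNorm_le_right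
      (circNorm_transpose_le hD₁) h.opNorm_le) h.opNorm_closedLoop_le)
  calc circNorm ν (P₁ - P) ≤ p ^ 2 * _ := circNorm_le_of_sylvester ν h₁.isLyapunov h.isLyapunov
        h.one_le_bound h₁.le_smul_one h.le_smul_one (h.costToGo_sub_eq h₁)
    _ ≤ _ := mul_le_mul_of_nonneg_left hS (sq_nonneg p)
    _ = 4 * p ^ 5 * modelErr ν A A₁ B B₁ := by ring

lemma circNorm_gain_source_le :
    circNorm ν ((B₁ - B)ᵀ * (P₁ * L₁)) +
      circNorm ν ((P₁ - P) * L₁ + P * drift A A₁ B B₁ K₁) ≤ 7 * p ^ 6 * modelErr ν A A₁ B B₁ := by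
  have hf := modelErr_nonneg ν A A₁ B B₁
  have hX := h.circNorm_costToGo_sub_le h₁ (ν := ν)
  have hD₁ := circNorm_drift_le ν A A₁ B B₁ h₁.one_le_bound h₁.opNorm_gain_le
  have hU := circNorm_mul_le_of_opNorm_le_right
    (circNorm_transpose_le (circNorm_sub_le_modelErr_right ν A A₁ B B₁))
    (circNorm_mul_le_of_opNorm_le_left (ν := .op) h₁.opNorm_le h₁.opNorm_closedLoop_le)
  have hV := circNorm_add_le_of_le
    (circNorm_mul_le_of_opNorm_le_right hX h₁.opNorm_closedLoop_le)
    (circNorm_mul_le_of_opNorm_le_left h.opNorm_le hD₁)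
  have hpow : p ^ 2 * modelErr ν A A₁ B B₁ ≤ p ^ 6 * modelErr ν A A₁ B B₁ := by
    gcongr
    exacts [h.one_le_bound, by norm_num]
  linarith

lemma circNorm_gain_sub_le : circNorm ν (K₁ - K) ≤ 7 * p ^ 6 * modelErr ν A A₁ B B₁ := by
  rw [h.gain_sub_eq h₁, circNorm_neg]
  exact (h.circNorm_inv_mul_add_le ν _ _).trans (h.circNorm_gain_source_le h₁)

lemma circNorm_mul_gain_sub_le : circNorm ν (B * (K₁ - K)) ≤ 7 * p ^ 6 * modelErr ν A A₁ B B₁ := by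
  rw [h.gain_sub_eq h₁, Matrix.mul_neg, circNorm_neg]
  exact (h.circNorm_mul_inv_mul_add_le ν _ _).trans (h.circNorm_gain_source_le h₁)

lemma circNorm_closedLoop_sub_le : circNorm ν (L₁ - L) ≤ 9 * p ^ 6 * modelErr ν A A₁ B B₁ := by
  have hf := modelErr_nonneg ν A A₁ B B₁
  have hD₁ := circNorm_drift_le ν A A₁ B B₁ h₁.one_le_bound h₁.opNorm_gain_le
  have hpow : p * modelErr ν A A₁ B B₁ ≤ p ^ 6 * modelErr ν A A₁ B B₁ := by
    gcongr
    exact le_self_pow₀ h.one_le_bound (by norm_num)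
  have hsum := circNorm_add_le_of_le hD₁ (h.circNorm_mul_gain_sub_le h₁ (ν := ν))
  rw [h.closedLoop_sub_eq h₁]
  linarith

lemma circNorm_model_sub_mul_gain_sub_le : circNorm ν ((B₁ - B) * (K₁ - K)) ≤
    7 * p ^ 6 * (modelErr .op A A₁ B B₁ * modelErr ν A A₁ B B₁) :=
  (circNorm_mul_le_of_opNorm_le_left (circNorm_sub_le_modelErr_right .op A A₁ B B₁)
    (h.circNorm_gain_sub_le h₁)).trans_eq (by ring)

lemma circNorm_costToGo_source_le :
    circNorm ν ((L₁ - L)ᵀ * ((P₁ - P) * L + P₁ * drift A A₁ B B₁ K) +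
      Lᵀ * (P₁ - P) * drift A A₁ B B₁ K + ((B₁ - B) * (K₁ - K))ᵀ * (P * L)) ≤
    69 * p ^ 12 * (modelErr .op A A₁ B B₁ * modelErr ν A A₁ B B₁) := by
  have hf := modelErr_nonneg ν A A₁ B B₁
  have he := modelErr_nonneg .op A A₁ B B₁
  have hp := h.one_le_bound
  have hD := circNorm_drift_le ν A A₁ B B₁ hp h.opNorm_gain_le
  have hfirst := circNorm_mul_le_of_opNorm_le_left
    (circNorm_transpose_le (ν := .op) (h.circNorm_closedLoop_sub_le h₁))
    (circNorm_add_le_of_le (circNorm_mul_le_of_opNorm_le_right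
      (h.circNorm_costToGo_sub_le h₁ (ν := ν)) h.opNorm_closedLoop_le)
      (circNorm_mul_le_of_opNorm_le_left h₁.opNorm_le hD))
  have hsecond := circNorm_mul_le_of_opNorm_le_left (circNorm_mul_le_of_opNorm_le_left (ν := .op)
    h.opNorm_closedLoop_transpose_le (h.circNorm_costToGo_sub_le h₁)) hD
  have hthird := circNorm_mul_le_of_opNorm_le_right
    (circNorm_transpose_le (h.circNorm_model_sub_mul_gain_sub_le h₁ (ν := ν)))
    (circNorm_mul_le_of_opNorm_le_left (ν := .op) h.opNorm_le h.opNorm_closedLoop_le)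
  set e := modelErr .op A A₁ B B₁
  set f := modelErr ν A A₁ B B₁
  have hpow {k : ℕ} (hk : k ≤ 12) : p ^ k * (e * f) ≤ p ^ 12 * (e * f) := by gcongr
  refine (circNorm_add_le_of_le (circNorm_add_le_of_le hfirst hsecond) hthird).trans ?_
  linarith [hpow (k := 7) (by norm_num), hpow (k := 8) (by norm_num)]

section SecondOrder

variable
  (hPd : Pd = Lᵀ * Pd * L + (Lᵀ * P * drift A A₁ B B₁ K + (drift A A₁ B B₁ K)ᵀ * P * L))
include hPd

lemma costToGo_sub_sub_eq :
    P₁ - P - Pd = Lᵀ * (P₁ - P - Pd) * L +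
      ((L₁ - L)ᵀ * ((P₁ - P) * L + P₁ * drift A A₁ B B₁ K) +
        Lᵀ * (P₁ - P) * drift A A₁ B B₁ K + ((B₁ - B) * (K₁ - K))ᵀ * (P * L)) := by
  rw [← drift_sub_drift (A := A) (A₁ := A₁)]
  conv_lhs => rw [h.costToGo_sub_eq h₁, hPd]
  simp only [transpose_sub, Matrix.mul_add, Matrix.sub_mul, Matrix.mul_sub, Matrix.mul_assoc]
  abel

lemma circNorm_costToGo_sub_sub_le :
    circNorm ν (P₁ - P - Pd) ≤
      69 * p ^ 14 * (modelErr .op A A₁ B B₁ * modelErr ν A A₁ B B₁) :=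
  calc circNorm ν (P₁ - P - Pd) ≤ p ^ 2 * _ := circNorm_le_of_sylvester ν h.isLyapunov h.isLyapunov
        h.one_le_bound h.le_smul_one h.le_smul_one (h.costToGo_sub_sub_eq h₁ hPd)
    _ ≤ _ := mul_le_mul_of_nonneg_left (h.circNorm_costToGo_source_le h₁) (sq_nonneg p)
    _ = 69 * p ^ 14 * (modelErr .op A A₁ B B₁ * modelErr ν A A₁ B B₁) := by ring

lemma circNorm_gain_sub_sub_gainDeriv_le :
    circNorm ν (K₁ - K - gainDeriv Ru B B₁ P L (drift A A₁ B B₁ K) Pd) ≤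
      125 * p ^ 15 * (modelErr .op A A₁ B B₁ * modelErr ν A A₁ B B₁) := by
  have hf := modelErr_nonneg ν A A₁ B B₁
  have he := modelErr_nonneg .op A A₁ B B₁
  have hp := h.one_le_bound
  have hX := h.circNorm_costToGo_sub_le h₁ (ν := ν)
  have hL := h.circNorm_closedLoop_sub_le h₁ (ν := ν)
  have hU := circNorm_mul_le_of_opNorm_le_left
    (circNorm_transpose_le (circNorm_sub_le_modelErr_right .op A A₁ B B₁))
    (circNorm_add_le_of_le (circNorm_mul_le_of_opNorm_le_right hX h₁.opNorm_closedLoop_le)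
      (circNorm_mul_le_of_opNorm_le_left h.opNorm_le hL))
  have hV := circNorm_add_le_of_le (circNorm_add_le_of_le
    (circNorm_mul_le_of_opNorm_le_right (h.circNorm_costToGo_sub_sub_le h₁ hPd (ν := ν))
      h.opNorm_closedLoop_le)
    (circNorm_mul_le_of_opNorm_le_left (h.circNorm_costToGo_sub_le h₁ (ν := .op)) hL))
    (circNorm_mul_le_of_opNorm_le_left h.opNorm_le
      (h.circNorm_model_sub_mul_gain_sub_le h₁ (ν := ν)))
  set e := modelErr .op A A₁ B B₁
  set f := modelErr ν A A₁ B B₁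
  have hpow {k : ℕ} (hk : k ≤ 15) : p ^ k * (e * f) ≤ p ^ 15 * (e * f) := by gcongr
  rw [h.gain_sub_sub_gainDeriv_eq h₁, circNorm_neg]
  refine (h.circNorm_inv_mul_add_le ν _ _).trans ((add_le_add hU hV).trans ?_)
  linarith [hpow (k := 6) (by norm_num), hpow (k := 7) (by norm_num), hpow (k := 11) (by norm_num)]

end SecondOrder

end Bounds

end IsOptimalLoop

end Expansion

section Taylor

variable {n m : ℕ} {Rx A A₁ : Matrix (Fin n) (Fin n) ℝ} {Ru : Matrix (Fin m) (Fin m) ℝ}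
  {B B₁ : Matrix (Fin n) (Fin m) ℝ} {p : ℝ}

lemma Stabilizable.exists_Kinf_expansion (hRx : 1 ≤ Rx) (hRu : 1 ≤ Ru) (hAB : Stabilizable A B)
    (hp : 1 ≤ p) (hPp : opNorm (Pinf Rx Ru A B) ≤ p)
    (hsafe : 54 * p ^ 5 * modelErr .op A A₁ B B₁ ≤ 1) :
    ∃ K' : Matrix (Fin m) (Fin n) ℝ, ∀ t : ℝ, |t| ≤ 1 →
      Stabilizable (A + t • (A₁ - A)) (B + t • (B₁ - B)) ∧
      ∀ ν, circNorm ν (Kinf Rx Ru (A + t • (A₁ - A)) (B + t • (B₁ - B)) -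
          (Kinf Rx Ru A B + t • K')) ≤
        125 * (2 * p) ^ 15 * (modelErr .op A A₁ B B₁ * modelErr ν A A₁ B B₁) * t ^ 2 := by
  have h := hAB.isOptimalLoop hRx hRu hp hPp
  have h₂ := hAB.isOptimalLoop hRx hRu (p := 2 * p) (by linarith) (by linarith)
  set P := Pinf Rx Ru A B
  set K := Kinf Rx Ru A B
  set L := A + B * K
  set D := drift A A₁ B B₁ K with hD
  obtain ⟨Pd, hPd⟩ :=
    h.isLyapunov.exists_eq_transpose_mul_mul_add hp h.le_smul_one (Lᵀ * P * D + Dᵀ * P * L)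
  refine ⟨gainDeriv Ru B B₁ P L D Pd, fun t ht => ?_⟩
  have hsafe_t : 54 * p ^ 5 * modelErr .op A (A + t • (A₁ - A)) B (B + t • (B₁ - B)) ≤ 1 := by
    rw [modelErr_add_smul_sub]
    refine le_trans ?_ hsafe
    gcongr
    exact mul_le_of_le_one_left (modelErr_nonneg _ _ _ _ _) ht
  have hstab := h.stabilizable_perturbed hsafe_t
  have hle := h.opNorm_perturbed_le hsafe_t (hstab.isDARESolution_Pinf hRx hRu)
  have hPd_t : t • Pd = Lᵀ * (t • Pd) * L + (Lᵀ * P * (t • D) + (t • D)ᵀ * P * L) := by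
    conv_lhs => rw [hPd]
    simp only [smul_add, transpose_smul, Matrix.smul_mul, Matrix.mul_smul]
  rw [hD, ← drift_add_smul_sub] at hPd_t
  refine ⟨hstab, fun ν => ?_⟩
  have hbound := h₂.circNorm_gain_sub_sub_gainDeriv_le
    (hstab.isOptimalLoop hRx hRu h₂.one_le_bound hle) hPd_t (ν := ν)
  rw [drift_add_smul_sub, gainDeriv_add_smul_sub, modelErr_add_smul_sub, modelErr_add_smul_sub,
    sub_sub] at hbound
  refine hbound.trans_eq ?_
  rw [← sq_abs t]
  ring

lemma Stabilizable.exists_Kinf_expansion_of_le_Csafe (hRx : 1 ≤ Rx) (hRu : 1 ≤ Ru)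
    (hAB : Stabilizable A B) (herr : modelErr .op A A₁ B B₁ ≤ 1 / Csafe Rx Ru A B) :
    ∃ K' : Matrix (Fin m) (Fin n) ℝ, ∀ t : ℝ, |t| ≤ 1 →
      Stabilizable (A + t • (A₁ - A)) (B + t • (B₁ - B)) ∧
      ∀ ν, circNorm ν (Kinf Rx Ru (A + t • (A₁ - A)) (B + t • (B₁ - B)) -
          (Kinf Rx Ru A B + t • K')) ≤
        125 * (2 * opNorm (Pinf Rx Ru A B)) ^ 15 *
          (modelErr .op A A₁ B B₁ * modelErr ν A A₁ B B₁) * t ^ 2 := by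
  rcases eq_zero_or_neZero n with rfl | hn
  · refine ⟨0, fun t _ => ⟨?_, fun ν => ?_⟩⟩
    · rwa [Subsingleton.elim (A + t • (A₁ - A)) A, Subsingleton.elim (B + t • (B₁ - B)) B]
    · have hs := opNorm_nonneg (Pinf Rx Ru A B)
      have he := modelErr_nonneg .op A A₁ B B₁
      have hf := modelErr_nonneg ν A A₁ B B₁
      rw [(circNorm_eq_zero ν).2 (Subsingleton.elim _ 0)]
      positivity
  · have hs := hAB.one_le_opNorm_Pinf hRx hRu
    rw [Csafe, le_div_iff₀ (by positivity), mul_comm] at herr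
    exact hAB.exists_Kinf_expansion hRx hRu hs le_rfl herr

open scoped Matrix.Norms.L2Operator in
lemma hasDerivAt_zero_of_opNorm_sub_le {f : ℝ → Matrix (Fin m) (Fin n) ℝ}
    {f' : Matrix (Fin m) (Fin n) ℝ} {C : ℝ}
    (h : ∀ t : ℝ, |t| ≤ 1 → opNorm (f t - (f 0 + t • f')) ≤ C * t ^ 2) : HasDerivAt f f' 0 := by
  rw [hasDerivAt_iff_isLittleO_nhds_zero]
  have hO : (fun t : ℝ => f (0 + t) - f 0 - t • f') =O[𝓝 0] fun t : ℝ => t ^ 2 := by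
    refine Asymptotics.IsBigO.of_bound C ?_
    filter_upwards [Metric.closedBall_mem_nhds (0 : ℝ) one_pos] with t ht
    rw [zero_add, sub_sub, Real.norm_of_nonneg (sq_nonneg t)]
    exact h t (by simpa using ht)
  simpa using hO.trans_isLittleO (Asymptotics.isLittleO_pow_pow (m := 1) one_lt_two)

end Taylor

end LQR

theorem mainTheorem8_general :
    ∃ c p : ℝ, 0 < c ∧ 0 < p ∧
      ∀ (n m : ℕ) (Rx : Matrix (Fin n) (Fin n) ℝ) (Ru : Matrix (Fin m) (Fin m) ℝ)
        (A A' : Matrix (Fin n) (Fin n) ℝ) (B B' : Matrix (Fin n) (Fin m) ℝ),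
        (Rx - 1).PosSemidef →
        (Ru - 1).PosSemidef →
        LQR.Stabilizable A B →
        LQR.modelErr MatNorm.op A A' B B' ≤ 1 / LQR.Csafe Rx Ru A B →
        (∀ t ∈ Set.Icc (0 : ℝ) 1, LQR.Stabilizable (A + t • (A' - A)) (B + t • (B' - B))) ∧
        ∃ K' : Matrix (Fin m) (Fin n) ℝ,
          HasDerivAt
            (fun t : ℝ => LQR.Kinf Rx Ru (A + t • (A' - A)) (B + t • (B' - B))) K' 0 ∧
          ∀ ν : MatNorm,
            LQR.circNorm ν (LQR.Kinf Rx Ru A' B' - (LQR.Kinf Rx Ru A B + K')) ^ 2 ≤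
              c * opNorm (LQR.Pinf Rx Ru A B) ^ p *
                LQR.modelErr MatNorm.op A A' B B' ^ 2 * LQR.modelErr ν A A' B B' ^ 2 := by
  refine ⟨(125 * 2 ^ 15) ^ 2, (30 : ℕ), by norm_num, by norm_num, ?_⟩
  intro n m Rx Ru A A' B B' hRx hRu hAB herr
  obtain ⟨K', hK'⟩ := hAB.exists_Kinf_expansion_of_le_Csafe
    (Matrix.le_iff.2 hRx) (Matrix.le_iff.2 hRu) herr
  refine ⟨fun t ht => (hK' t (abs_le.2 ⟨by linarith [ht.1], ht.2⟩)).1, K', ?_, fun ν => ?_⟩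
  · exact LQR.hasDerivAt_zero_of_opNorm_sub_le fun t ht => by
      simpa only [zero_smul, add_zero, LQR.circNorm] using (hK' t ht).2 .op
  · have hend := (hK' 1 (by simp)).2 ν
    simp only [one_smul, add_sub_cancel, one_pow, mul_one] at hend
    rw [Real.rpow_natCast]
    exact (pow_le_pow_left₀ (LQR.circNorm_nonneg ν _) hend 2).trans_eq (by ring)

theorem mainTheorem8 :
    ∃ c p : ℝ, 0 < c ∧ 0 < p ∧
      ∀ (n m : ℕ) (Rx : Matrix (Fin n) (Fin n) ℝ) (Ru : Matrix (Fin m) (Fin m) ℝ)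
        (A A' : Matrix (Fin n) (Fin n) ℝ) (B B' : Matrix (Fin n) (Fin m) ℝ),
        (Rx - 1).PosSemidef →
        Ru = 1 →
        LQR.Stabilizable A B →
        LQR.modelErr MatNorm.op A A' B B' ≤ 1 / LQR.Csafe Rx Ru A B →
        (∀ t ∈ Set.Icc (0 : ℝ) 1, LQR.Stabilizable (A + t • (A' - A)) (B + t • (B' - B))) ∧
        ∃ K' : Matrix (Fin m) (Fin n) ℝ,
          HasDerivAt
            (fun t : ℝ => LQR.Kinf Rx Ru (A + t • (A' - A)) (B + t • (B' - B))) K' 0 ∧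
          ∀ ν : MatNorm,
            LQR.circNorm ν (LQR.Kinf Rx Ru A' B' - (LQR.Kinf Rx Ru A B + K')) ^ 2 ≤
              c * opNorm (LQR.Pinf Rx Ru A B) ^ p *
                LQR.modelErr MatNorm.op A A' B B' ^ 2 * LQR.modelErr ν A A' B B' ^ 2 := by
  obtain ⟨c, p, hc, hp, h⟩ := mainTheorem8_general
  exact ⟨c, p, hc, hp, fun n m Rx Ru A A' B B' hRx hRu =>
    h n m Rx Ru A A' B B' hRx (by simpa [hRu] using Matrix.PosSemidef.zero)⟩
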